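/- Let $n\ge 1$, $\theta\in(0,1)$, $1\le q_0<p_0<\infty$, $1\le q_1<p_1<\infty$ with $\frac{p_0}{q_0}=\frac{p_1}{q_1}$, and define $p,q$ by $\frac1p=\frac{1-\theta}{p_0}+\frac{\theta}{p_1}$ and $\frac1q=\frac{1-\theta}{q_0}+\frac{\theta}{q_1}$. For $1\le s\le t<\infty$, a measurable $f:\mathbb R^n\to\mathbb C$ and $r>0$ put $$m(f,t,s;r)=\sup_{x\in\mathbb R^n}|B(x,r)|^{1/t}\Big(\frac1{|B(x,r)|}\int_{B(x,r)}|f(y)|^s\,dy\Big)^{1/s}.$$ The Morrey space $\mathcal M^t_s$ consists of all $f$ (modulo equality a.e.) with $\|f\|_{\mathcal M^t_s}=\sup_{r>0}m(f,t,s;r)<\infty$. Let $$V_\infty\mathcal M^t_s=\{f\in\mathcal M^t_s:\lim_{r\to\infty}m(f,t,s;r)=0\},$$ $$V^{(*)}\mathcal M^t_s=\Big\{f\in\mathcal M^t_s:\lim_{N\to\infty}\sup_{x\in\mathbb R^n}\int_{B(x,1)}|f(y)|^s\chi_{\mathbb R^n\setminus B(0,N)}(y)\,dy=0\Big\},$$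 both with the norm of $\mathcal M^t_s$. For a compatible couple $(X_0,X_1)$, the second complex interpolation space is $[X_0,X_1]^\theta=\{G'(\theta):G\in\mathcal G(X_0,X_1)\}$, where $\mathcal G(X_0,X_1)$ is the set of all continuous $G:\overline S\to X_0+X_1$, $S=\{z\in\mathbb C:0<\operatorname{Re}z<1\}$, such that $G$ is holomorphic in $S$, $\sup_{z\in\overline S}\|G(z)\|_{X_0+X_1}/(1+|z|)<\infty$, and for $k=0,1$ the function $t\mapsto G(k+it)$ is a Lipschitz function from $\mathbb R$ to $X_k$. Let $$E_m=\bigcup_{j=0}^{m-1}[j,j+m^{-nq/p}]\times[0,m]^{n-1}\quad(m\in\mathbb N,\ m\ge1),\qquad f_4(x)=\sum_{m=1}^\infty\chi_{E_m}(x-m!\,e_1).$$ Then $$f_4\in[V^{(*)}\mathcal M^{p_0}_{q_0},V^{(*)}\mathcal M^{p_1}_{q_1}]^\theta,\qquad f_4\notin[V_\infty\mathcal M^{p_0}_{q_0},V_\infty\mathcal M^{p_1}_{q_1}]^\theta.$$ Moreover, $f_4\in V^{(*)}\mathcal M^p_q$ and $f_4\notin V_\infty\mathcal M^p_q$. -/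

import Mathlib

open MeasureTheory Set Filter Topology
open scoped ENNReal Nat

noncomputable section

/-! ## Complex interpolation (second method) -/

/-- A compatible couple: two normed spaces `X₀`, `X₁` together with continuous linear embeddings
into a common Hausdorff topological vector space `Z`. -/
structure CompatibleCouple (X₀ X₁ Z : Type*)
    [NormedAddCommGroup X₀] [NormedSpace ℂ X₀] [NormedAddCommGroup X₁] [NormedSpace ℂ X₁]
    [AddCommGroup Z] [Module ℂ Z] [TopologicalSpace Z] [IsTopologicalAddGroup Z]
    [ContinuousSMul ℂ Z] [T2Space Z] where
  ι₀ : X₀ →L[ℂ] Z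
  ι₁ : X₁ →L[ℂ] Z
  injective₀ : Function.Injective ι₀
  injective₁ : Function.Injective ι₁

namespace CompatibleCouple

variable {X₀ X₁ Z : Type*}
    [NormedAddCommGroup X₀] [NormedSpace ℂ X₀] [NormedAddCommGroup X₁] [NormedSpace ℂ X₁]
    [AddCommGroup Z] [Module ℂ Z] [TopologicalSpace Z] [IsTopologicalAddGroup Z]
    [ContinuousSMul ℂ Z] [T2Space Z] (c : CompatibleCouple X₀ X₁ Z)

/-- The map `(x₀, x₁) ↦ x₀ + x₁` into `Z`, on `X₀ × X₁` with the norm `‖x₀‖ + ‖x₁‖`. -/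
def addMap : WithLp 1 (X₀ × X₁) →L[ℂ] Z :=
  (c.ι₀.coprod c.ι₁).comp (WithLp.prodContinuousLinearEquiv 1 ℂ X₀ X₁).toContinuousLinearMap

/-- The pairs `(x₀, x₁)` with `x₀ + x₁ = 0` in `Z`. -/
def relations : Submodule ℂ (WithLp 1 (X₀ × X₁)) := LinearMap.ker c.addMap.toLinearMap

instance isClosed_relations : IsClosed (c.relations : Set (WithLp 1 (X₀ × X₁))) :=
  c.addMap.isClosed_ker

/-- The sum space `X₀ + X₁`: pairs `(x₀, x₁)` up to having the same sum in `Z`. The quotient norm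
of `u` is the infimum of `‖x₀‖ + ‖x₁‖` over all decompositions `u = x₀ + x₁`. -/
def Sum : Type _ := WithLp 1 (X₀ × X₁) ⧸ c.relations

instance : NormedAddCommGroup c.Sum :=
  inferInstanceAs (NormedAddCommGroup (WithLp 1 (X₀ × X₁) ⧸ c.relations))

instance : NormedSpace ℂ c.Sum :=
  inferInstanceAs (NormedSpace ℂ (WithLp 1 (X₀ × X₁) ⧸ c.relations))

/-- The class of a pair `(x₀, x₁)`, that is, the element `x₀ + x₁` of `X₀ + X₁`. -/
def mkSum : WithLp 1 (X₀ × X₁) →ₗ[ℂ] c.Sum := c.relations.mkQ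

/-- The inclusion of `X₀ + X₁` into `Z`. -/
def toZ : c.Sum →ₗ[ℂ] Z := c.relations.liftQ c.addMap.toLinearMap le_rfl

/-- The inclusion of `X₀` into `X₀ + X₁`. -/
def incl₀ (x : X₀) : c.Sum := c.mkSum (WithLp.toLp 1 (x, 0))

/-- The inclusion of `X₁` into `X₀ + X₁`. -/
def incl₁ (x : X₁) : c.Sum := c.mkSum (WithLp.toLp 1 (0, x))

/-- The open strip `0 < Re z < 1`. -/
def openStrip : Set ℂ := {z | 0 < z.re ∧ z.re < 1}

/-- The closed strip `0 ≤ Re z ≤ 1`. -/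
def closedStrip : Set ℂ := {z | 0 ≤ z.re ∧ z.re ≤ 1}

/-- Membership in the Calderón class `𝒢(X₀, X₁)`; only the values of `G` on the closed strip
matter. -/
structure MemG (G : ℂ → c.Sum) : Prop where
  continuousOn : ContinuousOn G closedStrip
  holomorphic : DifferentiableOn ℂ G openStrip
  growth : ∃ C : ℝ, ∀ z ∈ closedStrip, ‖G z‖ ≤ C * (1 + ‖z‖)
  /-- `t ↦ G (it)` is a Lipschitz function with values in `X₀`. -/
  lip₀ : ∃ g : ℝ → X₀, (∀ t : ℝ, G (t * Complex.I) = c.incl₀ (g t)) ∧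
    ∃ K, LipschitzWith K g
  /-- `t ↦ G (1 + it)` is a Lipschitz function with values in `X₁`. -/
  lip₁ : ∃ g : ℝ → X₁, (∀ t : ℝ, G (1 + t * Complex.I) = c.incl₁ (g t)) ∧
    ∃ K, LipschitzWith K g

/-- The second complex interpolation space `[X₀, X₁]^θ = {G'(θ) : G ∈ 𝒢(X₀, X₁)}`, as a subset
of `Z`. -/
def secondInterp (θ : ℝ) : Set Z :=
  {f | ∃ G : ℂ → c.Sum, c.MemG G ∧ f = c.toZ (deriv G (θ : ℂ))}

end CompatibleCouple

/-! ## Morrey spaces and vanishing Morrey spaces on `ℝⁿ` -/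

/-- `m(f, p, q; r) = sup_x |B(x,r)|^{1/p} (|B(x,r)|⁻¹ ∫_{B(x,r)} |f|^q)^{1/q}`. -/
def morreyMean {n : ℕ} (f : EuclideanSpace ℝ (Fin n) → ℂ) (p q r : ℝ) : ℝ≥0∞ :=
  ⨆ x : EuclideanSpace ℝ (Fin n), volume (Metric.ball x r) ^ (1 / p) *
    ((volume (Metric.ball x r))⁻¹ * ∫⁻ y in Metric.ball x r, ‖f y‖ₑ ^ q) ^ (1 / q)

/-- The Morrey norm `sup_{r > 0} m(f, p, q; r)`, possibly infinite. -/
def morreyENorm {n : ℕ} (f : EuclideanSpace ℝ (Fin n) → ℂ) (p q : ℝ) : ℝ≥0∞ :=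
  ⨆ (r : ℝ) (_ : 0 < r), morreyMean f p q r

/-- `f ∈ M^p_q`: `f` is measurable with finite Morrey norm (so that `f ∈ L^q_loc`). -/
def MemMorrey {n : ℕ} (f : EuclideanSpace ℝ (Fin n) → ℂ) (p q : ℝ) : Prop :=
  AEStronglyMeasurable f volume ∧ morreyENorm f p q < ∞

/-- `f ∈ V_∞ M^p_q`. -/
def MemVInf {n : ℕ} (f : EuclideanSpace ℝ (Fin n) → ℂ) (p q : ℝ) : Prop :=
  MemMorrey f p q ∧ Tendsto (fun r : ℝ => morreyMean f p q r) atTop (𝓝 0)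

/-- `sup_x ∫_{B(x,1)} |f|^q χ_{ℝⁿ ∖ B(0,N)}`. -/
def tailMass {n : ℕ} (f : EuclideanSpace ℝ (Fin n) → ℂ) (q : ℝ) (N : ℕ) : ℝ≥0∞ :=
  ⨆ x : EuclideanSpace ℝ (Fin n), ∫⁻ y in Metric.ball x 1,
    (Metric.ball (0 : EuclideanSpace ℝ (Fin n)) N)ᶜ.indicator (fun y => ‖f y‖ₑ ^ q) y

/-- `f ∈ V^{(*)} M^p_q`. -/
def MemVStar {n : ℕ} (f : EuclideanSpace ℝ (Fin n) → ℂ) (p q : ℝ) : Prop :=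
  MemMorrey f p q ∧ Tendsto (fun N : ℕ => tailMass f q N) atTop (𝓝 0)

section Facts

variable {n : ℕ} {f g : EuclideanSpace ℝ (Fin n) → ℂ} {p q r : ℝ}

theorem morreyMean_congr (h : f =ᵐ[volume] g) : morreyMean f p q r = morreyMean g p q r := by
  unfold morreyMean
  refine iSup_congr fun x => ?_
  rw [lintegral_congr_ae (μ := volume.restrict (Metric.ball x r))
    (g := fun y => ‖g y‖ₑ ^ q)]
  exact (ae_restrict_of_ae h).mono fun y hy => by simp only [hy]

theorem morreyENorm_congr (h : f =ᵐ[volume] g) : morreyENorm f p q = morreyENorm g p q := by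
  unfold morreyENorm
  simp only [morreyMean_congr h]

theorem tailMass_congr (h : f =ᵐ[volume] g) (N : ℕ) : tailMass f q N = tailMass g q N := by
  unfold tailMass
  refine iSup_congr fun x => lintegral_congr_ae ?_
  exact (ae_restrict_of_ae h).mono fun y hy => by simp only [indicator, hy]

theorem MemMorrey.congr (hf : MemMorrey f p q) (h : f =ᵐ[volume] g) : MemMorrey g p q :=
  ⟨hf.1.congr h, morreyENorm_congr (p := p) (q := q) h ▸ hf.2⟩

theorem MemVInf.congr (hf : MemVInf f p q) (h : f =ᵐ[volume] g) : MemVInf g p q :=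
  ⟨hf.1.congr h, by simpa only [morreyMean_congr h] using hf.2⟩

theorem MemVStar.congr (hf : MemVStar f p q) (h : f =ᵐ[volume] g) : MemVStar g p q :=
  ⟨hf.1.congr h, by simpa only [tailMass_congr h] using hf.2⟩

theorem morreyMean_zero (hq : 1 ≤ q) :
    morreyMean (0 : EuclideanSpace ℝ (Fin n) → ℂ) p q r = 0 := by
  have h0 : 0 < q := by linarith
  simp [morreyMean, h0, ENNReal.zero_rpow_of_pos]

theorem morreyMean_add_le (hq : 1 ≤ q) (hf : AEStronglyMeasurable f volume)
    (hg : AEStronglyMeasurable g volume) :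
    morreyMean (f + g) p q r ≤ morreyMean f p q r + morreyMean g p q r := by
  have h0 : 0 < q := by linarith
  refine iSup_le fun x => ?_
  refine le_trans ?_ (add_le_add
    (le_iSup (fun x => volume (Metric.ball x r) ^ (1 / p) *
      ((volume (Metric.ball x r))⁻¹ * ∫⁻ y in Metric.ball x r, ‖f y‖ₑ ^ q) ^ (1 / q)) x)
    (le_iSup (fun x => volume (Metric.ball x r) ^ (1 / p) *
      ((volume (Metric.ball x r))⁻¹ * ∫⁻ y in Metric.ball x r, ‖g y‖ₑ ^ q) ^ (1 / q)) x))
  rw [← mul_add]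
  refine mul_le_mul_right ?_ _
  simp only [ENNReal.mul_rpow_of_nonneg _ _ (one_div_nonneg.2 h0.le)]
  rw [← mul_add]
  refine mul_le_mul_right ?_ _
  refine le_trans ?_ (ENNReal.lintegral_Lp_add_le (hf.enorm.restrict) (hg.enorm.restrict) hq)
  refine ENNReal.rpow_le_rpow (lintegral_mono fun y => ?_) (one_div_nonneg.2 h0.le)
  exact ENNReal.rpow_le_rpow (enorm_add_le _ _) h0.le

theorem morreyMean_smul (hq : 1 ≤ q) (c : ℂ) :
    morreyMean (c • f) p q r = ‖c‖ₑ * morreyMean f p q r := by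
  have h0 : 0 < q := by linarith
  unfold morreyMean
  rw [ENNReal.mul_iSup]
  refine iSup_congr fun x => ?_
  have : ∫⁻ y in Metric.ball x r, ‖(c • f) y‖ₑ ^ q
      = ‖c‖ₑ ^ q * ∫⁻ y in Metric.ball x r, ‖f y‖ₑ ^ q := by
    rw [← lintegral_const_mul' _ _ (ENNReal.rpow_ne_top_of_nonneg h0.le enorm_ne_top)]
    refine lintegral_congr fun y => ?_
    rw [Pi.smul_apply, enorm_smul, ENNReal.mul_rpow_of_nonneg _ _ h0.le]
  rw [this, mul_left_comm, ENNReal.mul_rpow_of_nonneg _ _ (one_div_nonneg.2 h0.le),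
    ← ENNReal.rpow_mul, mul_one_div_cancel h0.ne', ENNReal.rpow_one, mul_left_comm]

theorem morreyENorm_zero (hq : 1 ≤ q) :
    morreyENorm (0 : EuclideanSpace ℝ (Fin n) → ℂ) p q = 0 := by
  simp [morreyENorm, morreyMean_zero hq]

theorem morreyENorm_add_le (hq : 1 ≤ q) (hf : AEStronglyMeasurable f volume)
    (hg : AEStronglyMeasurable g volume) :
    morreyENorm (f + g) p q ≤ morreyENorm f p q + morreyENorm g p q := by
  refine iSup₂_le fun r hr => (morreyMean_add_le hq hf hg).trans (add_le_add ?_ ?_)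
  · exact le_iSup₂ (f := fun r (_ : (0:ℝ) < r) => morreyMean f p q r) r hr
  · exact le_iSup₂ (f := fun r (_ : (0:ℝ) < r) => morreyMean g p q r) r hr

theorem morreyENorm_smul (hq : 1 ≤ q) (c : ℂ) :
    morreyENorm (c • f) p q = ‖c‖ₑ * morreyENorm f p q := by
  simp only [morreyENorm, morreyMean_smul hq, ENNReal.mul_iSup]

theorem tailMass_zero (hq : 1 ≤ q) (N : ℕ) :
    tailMass (0 : EuclideanSpace ℝ (Fin n) → ℂ) q N = 0 := by
  have h0 : 0 < q := by linarith
  simp [tailMass, h0, ENNReal.zero_rpow_of_pos]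

theorem tailMass_add_le (hq : 1 ≤ q) (hf : AEStronglyMeasurable f volume) (N : ℕ) :
    tailMass (f + g) q N ≤ 2 ^ (q - 1) * (tailMass f q N + tailMass g q N) := by
  have h0 : 0 < q := by linarith
  set S : Set (EuclideanSpace ℝ (Fin n)) := (Metric.ball 0 N)ᶜ with hS
  have hSm : MeasurableSet S := Metric.isOpen_ball.measurableSet.compl
  refine iSup_le fun x => ?_
  calc ∫⁻ y in Metric.ball x 1, S.indicator (fun y => ‖(f + g) y‖ₑ ^ q) y
      ≤ ∫⁻ y in Metric.ball x 1, 2 ^ (q - 1) * (S.indicator (fun y => ‖f y‖ₑ ^ q) y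
          + S.indicator (fun y => ‖g y‖ₑ ^ q) y) := by
        refine lintegral_mono fun y => ?_
        by_cases hy : y ∈ S
        · simp only [indicator_of_mem hy]
          exact (ENNReal.rpow_le_rpow (enorm_add_le _ _) h0.le).trans
            (ENNReal.rpow_add_le_mul_rpow_add_rpow _ _ hq)
        · simp [indicator_of_notMem hy]
    _ = 2 ^ (q - 1) * ((∫⁻ y in Metric.ball x 1, S.indicator (fun y => ‖f y‖ₑ ^ q) y)
          + ∫⁻ y in Metric.ball x 1, S.indicator (fun y => ‖g y‖ₑ ^ q) y) := by
        rw [lintegral_const_mul' _ _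
          (ENNReal.rpow_ne_top_of_nonneg (by linarith) (by norm_num)), lintegral_add_left']
        exact ((hf.enorm.pow_const q).indicator hSm).restrict
    _ ≤ _ := by
        refine mul_le_mul_right (add_le_add ?_ ?_) _
        · exact le_iSup (fun x => ∫⁻ y in Metric.ball x 1,
            S.indicator (fun y => ‖f y‖ₑ ^ q) y) x
        · exact le_iSup (fun x => ∫⁻ y in Metric.ball x 1,
            S.indicator (fun y => ‖g y‖ₑ ^ q) y) x

theorem tailMass_smul (hq : 1 ≤ q) (c : ℂ) (N : ℕ) :
    tailMass (c • f) q N = ‖c‖ₑ ^ q * tailMass f q N := by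
  have h0 : 0 < q := by linarith
  unfold tailMass
  rw [ENNReal.mul_iSup]
  refine iSup_congr fun x => ?_
  rw [← lintegral_const_mul' _ _ (ENNReal.rpow_ne_top_of_nonneg h0.le enorm_ne_top)]
  refine lintegral_congr fun y => ?_
  by_cases hy : y ∈ (Metric.ball (0 : EuclideanSpace ℝ (Fin n)) N)ᶜ
  · simp only [indicator_of_mem hy]
    rw [Pi.smul_apply, enorm_smul, ENNReal.mul_rpow_of_nonneg _ _ h0.le]
  · simp only [indicator_of_notMem hy, mul_zero]

theorem MemMorrey.zero (hq : 1 ≤ q) : MemMorrey (0 : EuclideanSpace ℝ (Fin n) → ℂ) p q :=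
  ⟨aestronglyMeasurable_zero, by simp [morreyENorm_zero hq]⟩

theorem MemMorrey.add (hq : 1 ≤ q) (hf : MemMorrey f p q) (hg : MemMorrey g p q) :
    MemMorrey (f + g) p q :=
  ⟨hf.1.add hg.1, (morreyENorm_add_le hq hf.1 hg.1).trans_lt (ENNReal.add_lt_top.2 ⟨hf.2, hg.2⟩)⟩

theorem MemMorrey.smul (hq : 1 ≤ q) (c : ℂ) (hf : MemMorrey f p q) : MemMorrey (c • f) p q :=
  ⟨hf.1.const_smul c, by
    rw [morreyENorm_smul hq]; exact ENNReal.mul_lt_top enorm_lt_top hf.2⟩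

theorem MemVInf.add (hq : 1 ≤ q) (hf : MemVInf f p q) (hg : MemVInf g p q) :
    MemVInf (f + g) p q := by
  refine ⟨hf.1.add hq hg.1, ?_⟩
  have h := hf.2.add hg.2
  rw [add_zero] at h
  exact tendsto_of_tendsto_of_tendsto_of_le_of_le tendsto_const_nhds h (fun _ => zero_le)
    (fun r => morreyMean_add_le hq hf.1.1 hg.1.1)

theorem MemVInf.smul (hq : 1 ≤ q) (c : ℂ) (hf : MemVInf f p q) : MemVInf (c • f) p q := by
  refine ⟨hf.1.smul hq c, ?_⟩
  have h := ENNReal.Tendsto.const_mul hf.2 (Or.inr (enorm_ne_top (x := c)))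
  simpa only [morreyMean_smul hq, mul_zero] using h

theorem MemVStar.add (hq : 1 ≤ q) (hf : MemVStar f p q) (hg : MemVStar g p q) :
    MemVStar (f + g) p q := by
  refine ⟨hf.1.add hq hg.1, ?_⟩
  have h := ENNReal.Tendsto.const_mul (a := 2 ^ (q - 1)) (hf.2.add hg.2)
    (Or.inr (ENNReal.rpow_ne_top_of_nonneg (by linarith) (by norm_num)))
  rw [add_zero, mul_zero] at h
  exact tendsto_of_tendsto_of_tendsto_of_le_of_le tendsto_const_nhds h (fun _ => zero_le)
    (fun N => tailMass_add_le hq hf.1.1 N)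

theorem MemVStar.smul (hq : 1 ≤ q) (c : ℂ) (hf : MemVStar f p q) : MemVStar (c • f) p q := by
  refine ⟨hf.1.smul hq c, ?_⟩
  have h := ENNReal.Tendsto.const_mul (a := ‖c‖ₑ ^ q) hf.2
    (Or.inr (ENNReal.rpow_ne_top_of_nonneg (by linarith) enorm_ne_top))
  simpa only [tailMass_smul hq, mul_zero] using h

/-- Hölder's inequality: on a ball, the `L¹` norm is controlled by the Morrey norm. -/
theorem lintegral_ball_le_morreyENorm (n : ℕ) (p : ℝ) (hq : 1 ≤ q) (hr : 0 < r) :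
    ∃ C : NNReal, ∀ g : EuclideanSpace ℝ (Fin n) → ℂ, AEStronglyMeasurable g volume →
      ∫⁻ y in Metric.ball (0 : EuclideanSpace ℝ (Fin n)) r, ‖g y‖ₑ ≤ C * morreyENorm g p q := by
  have h0 : 0 < q := by linarith
  set B : Set (EuclideanSpace ℝ (Fin n)) := Metric.ball 0 r with hB
  set v : ℝ≥0∞ := volume B with hv
  have hv0 : v ≠ 0 := (Metric.measure_ball_pos volume _ hr).ne'
  have hvt : v ≠ ∞ := measure_ball_lt_top.ne
  have hrt : ∀ s : ℝ, v ^ s ≠ ∞ := fun s => ENNReal.rpow_ne_top_of_ne_zero hv0 hvt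
  refine ⟨(v ^ (1 - 1 / p)).toNNReal, fun g hg => ?_⟩
  rw [ENNReal.coe_toNNReal (hrt _)]
  have h1 := eLpNorm'_le_eLpNorm'_mul_rpow_measure_univ (μ := volume.restrict B) one_pos hq
    hg.restrict
  simp only [eLpNorm'_eq_lintegral_enorm, ENNReal.rpow_one, one_div_one,
    Measure.restrict_apply_univ] at h1
  refine h1.trans ?_
  have h2 : v ^ (1 / p) * (v⁻¹ * ∫⁻ y in B, ‖g y‖ₑ ^ q) ^ (1 / q) ≤ morreyENorm g p q :=
    (le_iSup (fun x => volume (Metric.ball x r) ^ (1 / p) *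
      ((volume (Metric.ball x r))⁻¹ * ∫⁻ y in Metric.ball x r, ‖g y‖ₑ ^ q) ^ (1 / q))
        (0 : EuclideanSpace ℝ (Fin n))).trans
      (le_iSup₂ (f := fun r (_ : (0:ℝ) < r) => morreyMean g p q r) r hr)
  refine le_trans (le_of_eq ?_) (mul_le_mul_right h2 (v ^ (1 - 1 / p)))
  rw [ENNReal.mul_rpow_of_nonneg _ _ (one_div_nonneg.2 h0.le), ENNReal.inv_rpow,
    ← ENNReal.rpow_neg, ← mul_assoc, ← mul_assoc, ← ENNReal.rpow_add _ _ hv0 hvt,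
    ← ENNReal.rpow_add _ _ hv0 hvt, mul_comm]
  congr 2
  ring

theorem MemMorrey.integrableOn_ball (hq : 1 ≤ q) (hf : MemMorrey f p q) (hr : 0 < r) :
    IntegrableOn f (Metric.ball 0 r) volume := by
  obtain ⟨C, hC⟩ := lintegral_ball_le_morreyENorm n p hq hr
  exact ⟨hf.1.restrict, (hC f hf.1).trans_lt (ENNReal.mul_lt_top ENNReal.coe_lt_top hf.2)⟩

theorem MemMorrey.locallyIntegrable (hq : 1 ≤ q) (hf : MemMorrey f p q) :
    LocallyIntegrable f volume := fun x =>
  ⟨Metric.ball 0 (‖x‖ + 1), Metric.isOpen_ball.mem_nhds (by simp),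
    hf.integrableOn_ball hq (by positivity)⟩

theorem ae_eq_zero_of_morreyENorm_eq_zero (hq : 1 ≤ q) (hf : AEStronglyMeasurable f volume)
    (h : morreyENorm f p q = 0) : f =ᵐ[volume] 0 := by
  have key : ∀ N : ℕ, ∀ᵐ y ∂volume.restrict
      (Metric.ball (0 : EuclideanSpace ℝ (Fin n)) ((N : ℝ) + 1)), f y = 0 := by
    intro N
    obtain ⟨C, hC⟩ := lintegral_ball_le_morreyENorm n p hq (r := (N : ℝ) + 1) (by positivity)
    have h1 := hC f hf
    rw [h, mul_zero, nonpos_iff_eq_zero, lintegral_eq_zero_iff' hf.enorm.restrict] at h1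
    exact h1.mono fun y hy => by simpa using hy
  have hU : (⋃ N : ℕ, Metric.ball (0 : EuclideanSpace ℝ (Fin n)) ((N : ℝ) + 1)) = univ := by
    refine eq_univ_of_forall fun x => mem_iUnion.2 ?_
    obtain ⟨N, hN⟩ := exists_nat_gt ‖x‖
    exact ⟨N, by simpa using hN.trans (lt_add_one _)⟩
  have h2 := (ae_restrict_iUnion_iff
    (fun N : ℕ => Metric.ball (0 : EuclideanSpace ℝ (Fin n)) ((N : ℝ) + 1))
    (fun y => f y = 0)).2 key
  rw [hU, Measure.restrict_univ] at h2
  exact h2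

end Facts

/-- `L¹_loc(ℝⁿ)`, as classes of functions modulo equality almost everywhere. -/
def L1loc (n : ℕ) : Submodule ℂ (EuclideanSpace ℝ (Fin n) →ₘ[volume] ℂ) where
  carrier := {f | LocallyIntegrable f volume}
  zero_mem' := (locallyIntegrable_zero (μ := volume)).congr AEEqFun.coeFn_zero.symm
  add_mem' := fun {f g} hf hg => (LocallyIntegrable.add hf hg).congr (AEEqFun.coeFn_add f g).symm
  smul_mem' := fun c f hf => (LocallyIntegrable.smul hf c).congr (AEEqFun.coeFn_smul c f).symm

theorem L1loc.integrable {n : ℕ} (f : L1loc n) (N : ℕ) :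
    Integrable (f : EuclideanSpace ℝ (Fin n) →ₘ[volume] ℂ)
      (volume.restrict (Metric.ball (0 : EuclideanSpace ℝ (Fin n)) N)) :=
  (f.2.integrableOn_isCompact (isCompact_closedBall 0 (N : ℝ))).mono_set
    Metric.ball_subset_closedBall

/-- The restrictions of a locally integrable function to the balls `B(0,N)`. -/
def L1loc.restrict (n : ℕ) : L1loc n →ₗ[ℂ] ((N : ℕ) →
    Lp ℂ 1 (volume.restrict (Metric.ball (0 : EuclideanSpace ℝ (Fin n)) N))) where
  toFun f N := (L1loc.integrable f N).toL1
  map_add' f g := by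
    funext N
    rw [Pi.add_apply, ← Integrable.toL1_add]
    exact (Integrable.toL1_eq_toL1_iff _ _ _ _).2 (ae_restrict_of_ae (AEEqFun.coeFn_add _ _))
  map_smul' c f := by
    funext N
    rw [RingHom.id_apply, Pi.smul_apply, ← Integrable.toL1_smul]
    exact (Integrable.toL1_eq_toL1_iff _ _ _ _).2 (ae_restrict_of_ae (AEEqFun.coeFn_smul _ _))

theorem L1loc.restrict_injective (n : ℕ) : Function.Injective (L1loc.restrict n) := by
  intro f g h
  refine Subtype.ext (AEEqFun.ext ?_)
  have hU : (⋃ N : ℕ, Metric.ball (0 : EuclideanSpace ℝ (Fin n)) N) = univ := by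
    refine eq_univ_of_forall fun x => mem_iUnion.2 ?_
    obtain ⟨N, hN⟩ := exists_nat_gt ‖x‖
    exact ⟨N, by simpa using hN⟩
  have h2 := (ae_restrict_iUnion_iff (μ := volume)
    (fun N : ℕ => Metric.ball (0 : EuclideanSpace ℝ (Fin n)) N)
    (fun y => (f : EuclideanSpace ℝ (Fin n) →ₘ[volume] ℂ) y
      = (g : EuclideanSpace ℝ (Fin n) →ₘ[volume] ℂ) y)).2
    fun N => (Integrable.toL1_eq_toL1_iff _ _ (L1loc.integrable f N) (L1loc.integrable g N)).1 (congrFun h N)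
  rwa [hU, Measure.restrict_univ] at h2

/-- The topology of `L¹` convergence on every ball. -/
instance L1loc.instTopologicalSpace (n : ℕ) : TopologicalSpace (L1loc n) :=
  TopologicalSpace.induced (L1loc.restrict n) inferInstance

instance (n : ℕ) : IsTopologicalAddGroup (L1loc n) := topologicalAddGroup_induced (L1loc.restrict n)

instance (n : ℕ) : ContinuousSMul ℂ (L1loc n) := continuousSMul_induced (L1loc.restrict n)

instance (n : ℕ) : T2Space (L1loc n) :=
  T2Space.of_injective_continuous (L1loc.restrict_injective n) continuous_induced_dom

/-- The Morrey space `M^p_q(ℝⁿ)`, `1 ≤ q`. -/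
def Morrey (n : ℕ) (p q : ℝ) (hq : 1 ≤ q) :
    Submodule ℂ (EuclideanSpace ℝ (Fin n) →ₘ[volume] ℂ) where
  carrier := {f | MemMorrey f p q}
  zero_mem' := (MemMorrey.zero hq).congr AEEqFun.coeFn_zero.symm
  add_mem' := fun {f g} hf hg => (MemMorrey.add hq hf hg).congr (AEEqFun.coeFn_add f g).symm
  smul_mem' := fun c f hf => (MemMorrey.smul hq c hf).congr (AEEqFun.coeFn_smul c f).symm

namespace Morrey

variable {n : ℕ} {p q : ℝ} {hq : 1 ≤ q}

instance : Norm (Morrey n p q hq) :=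
  ⟨fun f => (morreyENorm (f : EuclideanSpace ℝ (Fin n) →ₘ[volume] ℂ) p q).toReal⟩

theorem normedSpaceCore : NormedSpace.Core ℂ (Morrey n p q hq) where
  norm_nonneg _ := ENNReal.toReal_nonneg
  norm_smul c f := by
    change (morreyENorm (c • (f : EuclideanSpace ℝ (Fin n) →ₘ[volume] ℂ) :
      EuclideanSpace ℝ (Fin n) →ₘ[volume] ℂ) p q).toReal = _
    rw [morreyENorm_congr (AEEqFun.coeFn_smul _ _), morreyENorm_smul hq, ENNReal.toReal_mul,
      toReal_enorm]
    rfl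
  norm_triangle f g := by
    change (morreyENorm ((f : EuclideanSpace ℝ (Fin n) →ₘ[volume] ℂ) + g :
      EuclideanSpace ℝ (Fin n) →ₘ[volume] ℂ) p q).toReal ≤ _
    rw [morreyENorm_congr (AEEqFun.coeFn_add _ _)]
    exact (ENNReal.toReal_mono (ENNReal.add_ne_top.2 ⟨f.2.2.ne, g.2.2.ne⟩)
      (morreyENorm_add_le hq f.2.1 g.2.1)).trans ENNReal.toReal_add_le
  norm_eq_zero_iff f := by
    constructor
    · intro h
      have h1 : morreyENorm (f : EuclideanSpace ℝ (Fin n) →ₘ[volume] ℂ) p q = 0 :=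
        ((ENNReal.toReal_eq_zero_iff _).1 h).resolve_right f.2.2.ne
      exact Subtype.ext (AEEqFun.ext
        ((ae_eq_zero_of_morreyENorm_eq_zero hq f.2.1 h1).trans AEEqFun.coeFn_zero.symm))
    · rintro rfl
      change (morreyENorm (0 : EuclideanSpace ℝ (Fin n) →ₘ[volume] ℂ) p q).toReal = 0
      rw [morreyENorm_congr AEEqFun.coeFn_zero, morreyENorm_zero hq, ENNReal.toReal_zero]

instance : NormedAddCommGroup (Morrey n p q hq) := NormedAddCommGroup.ofCore normedSpaceCore

instance : NormedSpace ℂ (Morrey n p q hq) := NormedSpace.ofCore normedSpaceCore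

theorem le_L1loc : Morrey n p q hq ≤ L1loc n :=
  fun _ hf => MemMorrey.locallyIntegrable hq hf

/-- The inclusion of `M^p_q` into `L¹_loc`. -/
def toL1locₗ (n : ℕ) (p q : ℝ) (hq : 1 ≤ q) : Morrey n p q hq →ₗ[ℂ] L1loc n :=
  Submodule.inclusion le_L1loc

theorem norm_restrict_toL1locₗ (f : Morrey n p q hq) (N : ℕ) :
    ‖L1loc.restrict n (toL1locₗ n p q hq f) N‖ =
      (∫⁻ y in Metric.ball (0 : EuclideanSpace ℝ (Fin n)) N,
        ‖(f : EuclideanSpace ℝ (Fin n) →ₘ[volume] ℂ) y‖ₑ).toReal :=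
  (Integrable.norm_toL1_eq_lintegral_norm _ (L1loc.integrable (toL1locₗ n p q hq f) N)).trans
    (by simp only [ofReal_norm]; rfl)

theorem continuous_toL1locₗ : Continuous (toL1locₗ n p q hq) := by
  refine continuous_induced_rng.2 (continuous_pi fun N => ?_)
  obtain ⟨C, hC⟩ := lintegral_ball_le_morreyENorm n p hq (r := (N : ℝ) + 1) (by positivity)
  refine AddMonoidHomClass.continuous_of_bound
    ((LinearMap.proj N).comp ((L1loc.restrict n).comp (toL1locₗ n p q hq))) C fun f => ?_
  refine (norm_restrict_toL1locₗ f N).le.trans ?_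
  have hN : (N : ℝ) ≤ N + 1 := by linarith
  have h1 := ENNReal.toReal_mono (ENNReal.mul_lt_top ENNReal.coe_lt_top f.2.2).ne
    ((lintegral_mono_set (Metric.ball_subset_ball hN)).trans (hC _ f.2.1))
  rw [ENNReal.toReal_mul] at h1
  exact h1

/-- The inclusion of `M^p_q` into `L¹_loc`, as a continuous linear map. -/
def toL1loc (n : ℕ) (p q : ℝ) (hq : 1 ≤ q) : Morrey n p q hq →L[ℂ] L1loc n :=
  ⟨toL1locₗ n p q hq, continuous_toL1locₗ⟩

theorem toL1loc_injective : Function.Injective (toL1loc n p q hq) :=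
  Submodule.inclusion_injective le_L1loc

/-- The vanishing Morrey space at infinity `V_∞ M^p_q`, with the norm of `M^p_q`. -/
def vInf (n : ℕ) (p q : ℝ) (hq : 1 ≤ q) : Submodule ℂ (Morrey n p q hq) where
  carrier := {f | MemVInf (f : EuclideanSpace ℝ (Fin n) →ₘ[volume] ℂ) p q}
  zero_mem' := MemVInf.congr (f := 0)
    ⟨MemMorrey.zero hq, by simp only [morreyMean_zero hq, tendsto_const_nhds]⟩
    AEEqFun.coeFn_zero.symm
  add_mem' := fun {f g} hf hg => (MemVInf.add hq hf hg).congr (AEEqFun.coeFn_add _ _).symm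
  smul_mem' := fun c f hf => (MemVInf.smul hq c hf).congr (AEEqFun.coeFn_smul c _).symm

/-- The space `V^{(*)} M^p_q`, with the norm of `M^p_q`. -/
def vStar (n : ℕ) (p q : ℝ) (hq : 1 ≤ q) : Submodule ℂ (Morrey n p q hq) where
  carrier := {f | MemVStar (f : EuclideanSpace ℝ (Fin n) →ₘ[volume] ℂ) p q}
  zero_mem' := MemVStar.congr (f := 0)
    ⟨MemMorrey.zero hq, by simp only [tailMass_zero hq, tendsto_const_nhds]⟩
    AEEqFun.coeFn_zero.symm
  add_mem' := fun {f g} hf hg => (MemVStar.add hq hf hg).congr (AEEqFun.coeFn_add _ _).symm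
  smul_mem' := fun c f hf => (MemVStar.smul hq c hf).congr (AEEqFun.coeFn_smul c _).symm

/-- Two subspaces of Morrey spaces, as a compatible couple of subspaces of `L¹_loc`. -/
def couple {p₀ q₀ p₁ q₁ : ℝ} {hq₀ : 1 ≤ q₀} {hq₁ : 1 ≤ q₁}
    (V₀ : Submodule ℂ (Morrey n p₀ q₀ hq₀)) (V₁ : Submodule ℂ (Morrey n p₁ q₁ hq₁)) :
    CompatibleCouple V₀ V₁ (L1loc n) where
  ι₀ := (toL1loc n p₀ q₀ hq₀).comp V₀.subtypeL
  ι₁ := (toL1loc n p₁ q₁ hq₁).comp V₁.subtypeL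
  injective₀ := toL1loc_injective.comp Subtype.val_injective
  injective₁ := toL1loc_injective.comp Subtype.val_injective

end Morrey

/-- A function on `ℝⁿ` belongs to a set of a.e. classes of locally integrable functions. -/
def BelongsTo {n : ℕ} (f : EuclideanSpace ℝ (Fin n) → ℂ) (A : Set (L1loc n)) : Prop :=
  ∃ g ∈ A, f =ᵐ[volume] (g : EuclideanSpace ℝ (Fin n) →ₘ[volume] ℂ)

/-! ## The example -/

/-- `E_m = ⋃_{j=0}^{m-1} [j, j + m^{-nq/p}] × [0,m]^{n-1}`. -/
def slabSet (n : ℕ) [NeZero n] (p q : ℝ) (m : ℕ) : Set (EuclideanSpace ℝ (Fin n)) :=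
  ⋃ j ∈ Finset.range m, {x | x 0 ∈ Icc (j : ℝ) (j + (m : ℝ) ^ (-(n * q / p))) ∧
    ∀ i : Fin n, i ≠ 0 → x i ∈ Icc (0 : ℝ) m}

/-- `f₄(x) = ∑_{m ≥ 1} χ_{E_m}(x - m! e₁)`; for every `x` at most finitely many terms are
nonzero. -/
def f₄ (n : ℕ) [NeZero n] (p q : ℝ) (x : EuclideanSpace ℝ (Fin n)) : ℂ :=
  ∑' m : ℕ, (slabSet n p q (m + 1)).indicator 1
    (x - ((m + 1)! : ℝ) • EuclideanSpace.single (0 : Fin n) (1 : ℝ))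

end

/-! The function `f₄` is almost everywhere the indicator of the union `A` of the sets
`A_m = m! e₁ + E_m`. Since `q / p = q₀ / p₀ = q₁ / p₁`, this union is the same for all three
exponent pairs, and the whole question is about the measure of `A`.

*Membership.* The set `A_m` has measure at most `m ^ (n - n q / p)` and consists of slabs of width
`m ^ (-n q / p)` with unit spacing, so that `|A_m ∩ B(x, r)| = O(r ^ (n - n q / p))` uniformly in
`m` and `r ≥ 1`. The gaps between the `A_m` grow factorially, so the union obeys the same bound
(`exists_volume_slabUnion_inter_ball_le`), which for an indicator function is the Morrey condition
for each of the three pairs. Far away from the origin only thin slabs are left, so the tail masses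
tend to zero (`tailMass_indicator_slabUnion_le`). Hence `f₄` lies in `V^{(*)} M^{p₀}_{q₀}` and in
`V^{(*)} M^{p₁}_{q₁}`, and any element `x` of an intersection `X₀ ∩ X₁` is the derivative of
`G z = z x`.

*Non-membership.* The set `A_m` lies in a ball of radius comparable to `m` and there attains the
growth allowed by the Morrey condition. By Hölder's inequality the average of `|u|` over `A_m` is
therefore at most a constant times the Morrey mean of `u` at that radius
(`exists_average_le_morreyMean`), and tends to zero when `u` belongs to `V_∞`. The averages of `f₄`
over the `A_m` are all `1`, so `f₄` is not in the sum of the two spaces `V_∞`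
(`not_f₄_ae_eq_add`), and this sum contains every second complex interpolation space. -/

/-! ### Boxes and balls in Euclidean space -/

theorem abs_sub_lt_of_mem_ball {n : ℕ} {x y : EuclideanSpace ℝ (Fin n)} {r : ℝ}
    (h : y ∈ Metric.ball x r) (i : Fin n) : |y i - x i| < r :=
  lt_of_le_of_lt (by simpa using PiLp.norm_apply_le (y - x) i) (mem_ball_iff_norm.1 h)

section Slabs

variable {n : ℕ} [NeZero n] {p q : ℝ} {m : ℕ}

/-- The box `[s, t] × ∏_{i ≠ 0} [a i, b i]`; the first side plays a separate role because it is
the short side of the slabs that make up `E_m`. -/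
def slabBox (s t : ℝ) (a b : Fin n → ℝ) : Set (EuclideanSpace ℝ (Fin n)) :=
  {x | x 0 ∈ Icc s t ∧ ∀ i : Fin n, i ≠ 0 → x i ∈ Icc (a i) (b i)}

theorem slabBox_eq_preimage (s t : ℝ) (a b : Fin n → ℝ) :
    slabBox s t a b = WithLp.ofLp (p := 2) (V := Fin n → ℝ) ⁻¹'
      Icc (Function.update a 0 s) (Function.update b 0 t) := by
  ext x
  simp only [slabBox, mem_ofPred_eq, mem_preimage, ← pi_univ_Icc, mem_univ_pi]
  constructor
  · rintro ⟨h0, h⟩ i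
    by_cases hi : i = 0
    · subst hi; simpa using h0
    · simpa [hi] using h i hi
  · intro h
    exact ⟨by simpa using h 0, fun i hi => by simpa [hi] using h i⟩

theorem measurableSet_slabBox (s t : ℝ) (a b : Fin n → ℝ) : MeasurableSet (slabBox s t a b) := by
  rw [slabBox_eq_preimage]
  exact (PiLp.volume_preserving_ofLp (Fin n)).measurable measurableSet_Icc

theorem volume_slabBox (s t : ℝ) (a b : Fin n → ℝ) : volume (slabBox s t a b) =
    ENNReal.ofReal (t - s) * ∏ i ∈ Finset.univ.erase 0, ENNReal.ofReal (b i - a i) := by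
  rw [slabBox_eq_preimage, (PiLp.volume_preserving_ofLp (Fin n)).measure_preimage
    measurableSet_Icc.nullMeasurableSet, Real.volume_Icc_pi,
    ← Finset.mul_prod_erase Finset.univ _ (Finset.mem_univ 0)]
  congr 1
  refine Finset.prod_congr rfl fun i hi => ?_
  simp [Finset.ne_of_mem_erase hi]

theorem norm_le_of_forall_abs_le {R : ℝ} (hR : 0 ≤ R) {x : EuclideanSpace ℝ (Fin n)}
    (h : ∀ i, |x i| ≤ R) : ‖x‖ ≤ n * R := by
  have hn : (1 : ℝ) ≤ n := by exact_mod_cast NeZero.one_le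
  rw [EuclideanSpace.norm_eq, Real.sqrt_le_iff]
  refine ⟨by positivity, ?_⟩
  calc ∑ i, ‖x i‖ ^ 2 ≤ ∑ _i : Fin n, R ^ 2 :=
        Finset.sum_le_sum fun i _ => by
          rw [Real.norm_eq_abs]; exact pow_le_pow_left₀ (abs_nonneg _) (h i) 2
    _ = n * R ^ 2 := by simp
    _ ≤ (n * R) ^ 2 := by nlinarith [sq_nonneg R]

theorem volume_ball_eq (x : EuclideanSpace ℝ (Fin n)) {r : ℝ} (hr : 0 ≤ r) :
    volume (Metric.ball x r) = ENNReal.ofReal r ^ n *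
      volume (Metric.ball (0 : EuclideanSpace ℝ (Fin n)) 1) := by
  rw [Measure.addHaar_ball _ _ hr, finrank_euclideanSpace_fin, ENNReal.ofReal_pow hr]

/-! ### The measure of the translated slab sets -/

/-- The set `m! e₁ + E_m`. -/
def shiftedSlab (n : ℕ) [NeZero n] (p q : ℝ) (m : ℕ) : Set (EuclideanSpace ℝ (Fin n)) :=
  {x | x - (m ! : ℝ) • EuclideanSpace.single (0 : Fin n) (1 : ℝ) ∈ slabSet n p q m}

/-- The `j`-th slab of `m! e₁ + E_m`. -/
def shiftedPiece (n : ℕ) [NeZero n] (p q : ℝ) (m j : ℕ) : Set (EuclideanSpace ℝ (Fin n)) :=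
  slabBox (m ! + j) (m ! + j + (m : ℝ) ^ (-(n * q / p))) 0 fun _ => m

theorem shiftedSlab_eq_iUnion :
    shiftedSlab n p q m = ⋃ j ∈ Finset.range m, shiftedPiece n p q m j := by
  ext x
  simp only [shiftedSlab, slabSet, shiftedPiece, slabBox, mem_ofPred_eq, mem_iUnion]
  refine exists_congr fun j => exists_congr fun _ => ?_
  refine and_congr ?_ (forall_congr' fun i => forall_congr' fun hi => ?_)
  · simp only [PiLp.sub_apply, PiLp.smul_apply, PiLp.single_apply, if_true, smul_eq_mul,
      mul_one, mem_Icc]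
    constructor <;> rintro ⟨h1, h2⟩ <;> constructor <;> linarith
  · simp [hi]

theorem measurableSet_shiftedSlab : MeasurableSet (shiftedSlab n p q m) := by
  rw [shiftedSlab_eq_iUnion]
  exact Finset.measurableSet_biUnion _ fun j _ => measurableSet_slabBox _ _ _ _

theorem volume_shiftedPiece (j : ℕ) : volume (shiftedPiece n p q m j) =
    ENNReal.ofReal ((m : ℝ) ^ (-(n * q / p))) * (m : ℝ≥0∞) ^ (n - 1) := by
  rw [shiftedPiece, volume_slabBox]
  simp

theorem width_le_one (hp : 0 < p) (hq : 0 < q) : (m : ℝ) ^ (-(n * q / p)) ≤ 1 := by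
  have ha : 0 < n * q / p := by have := NeZero.pos n; positivity
  rcases Nat.eq_zero_or_pos m with rfl | hm
  · rw [Nat.cast_zero, Real.zero_rpow (by linarith)]; exact zero_le_one
  · exact Real.rpow_le_one_of_one_le_of_nonpos (by exact_mod_cast hm) (by linarith)

theorem width_lt_one (hp : 0 < p) (hq : 0 < q) (hm : 2 ≤ m) : (m : ℝ) ^ (-(n * q / p)) < 1 := by
  have ha : 0 < n * q / p := by have := NeZero.pos n; positivity
  exact Real.rpow_lt_one_of_one_lt_of_neg (by exact_mod_cast hm) (by linarith)

theorem natCast_mul_volume_shiftedPiece (hm : 1 ≤ m) :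
    (m : ℝ≥0∞) * (ENNReal.ofReal ((m : ℝ) ^ (-(n * q / p))) * (m : ℝ≥0∞) ^ (n - 1)) =
      ENNReal.ofReal ((m : ℝ) ^ (n - n * q / p)) := by
  have hm0 : (0 : ℝ) < m := by exact_mod_cast hm
  rw [mul_left_comm, ← pow_succ', Nat.sub_add_cancel NeZero.one_le, sub_eq_neg_add,
    Real.rpow_add hm0, ENNReal.ofReal_mul (by positivity), Real.rpow_natCast,
    ENNReal.ofReal_pow hm0.le, ENNReal.ofReal_natCast]

theorem volume_shiftedSlab_le (hm : 1 ≤ m) :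
    volume (shiftedSlab n p q m) ≤ ENNReal.ofReal ((m : ℝ) ^ (n - n * q / p)) := by
  rw [shiftedSlab_eq_iUnion]
  refine (measure_biUnion_finset_le _ _).trans_eq ?_
  simp only [volume_shiftedPiece, Finset.sum_const, Finset.card_range, nsmul_eq_mul]
  exact natCast_mul_volume_shiftedPiece hm

theorem volume_shiftedSlab (hp : 0 < p) (hq : 0 < q) (hm : 2 ≤ m) :
    volume (shiftedSlab n p q m) = ENNReal.ofReal ((m : ℝ) ^ (n - n * q / p)) := by
  rw [shiftedSlab_eq_iUnion, measure_biUnion_finset]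
  · simp only [volume_shiftedPiece, Finset.sum_const, Finset.card_range, nsmul_eq_mul]
    exact natCast_mul_volume_shiftedPiece (by omega)
  · have key : ∀ i j : ℕ, i < j →
        Disjoint (shiftedPiece n p q m i) (shiftedPiece n p q m j) := by
      intro i j hij
      refine Set.disjoint_left.2 fun x hx hy => ?_
      have h1 := hx.1.2
      have h2 := hy.1.1
      have h3 : (i : ℝ) + 1 ≤ j := by exact_mod_cast hij
      linarith [width_lt_one (n := n) hp hq hm]
    intro i _ j _ hij
    rcases lt_or_gt_of_ne hij with h | h
    · exact key i j h
    · exact (key j i h).symm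
  · exact fun j _ => measurableSet_slabBox _ _ _ _

theorem coord_zero_mem_of_mem_shiftedSlab (hp : 0 < p) (hq : 0 < q)
    {x : EuclideanSpace ℝ (Fin n)} (hx : x ∈ shiftedSlab n p q m) :
    x 0 ∈ Icc (m ! : ℝ) (m ! + m) := by
  rw [shiftedSlab_eq_iUnion] at hx
  simp only [mem_iUnion, Finset.mem_range] at hx
  obtain ⟨j, hj, h1, -⟩ := hx
  have h3 : (j : ℝ) + 1 ≤ m := by exact_mod_cast hj
  have h4 : (0 : ℝ) ≤ j := Nat.cast_nonneg j
  have h5 := width_le_one (n := n) (m := m) hp hq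
  exact ⟨by linarith [h1.1], by linarith [h1.2]⟩

theorem norm_sub_le_of_mem_shiftedSlab (hp : 0 < p) (hq : 0 < q)
    {x : EuclideanSpace ℝ (Fin n)} (hx : x ∈ shiftedSlab n p q m) :
    ‖x - (m ! : ℝ) • EuclideanSpace.single (0 : Fin n) (1 : ℝ)‖ ≤ n * m := by
  refine norm_le_of_forall_abs_le (Nat.cast_nonneg m) fun i => ?_
  by_cases hi : i = 0
  · subst hi
    have h := coord_zero_mem_of_mem_shiftedSlab hp hq hx
    simp only [PiLp.sub_apply, PiLp.smul_apply, PiLp.single_apply, if_true, smul_eq_mul,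
      mul_one]
    rw [abs_le]
    exact ⟨by linarith [h.1, Nat.cast_nonneg (α := ℝ) m], by linarith [h.2]⟩
  · rw [shiftedSlab_eq_iUnion] at hx
    simp only [mem_iUnion, Finset.mem_range] at hx
    obtain ⟨j, -, -, h2⟩ := hx
    have h := h2 i hi
    simp only [Pi.zero_apply] at h
    simp only [PiLp.sub_apply, PiLp.smul_apply, PiLp.single_apply, hi, if_false,
      smul_zero, sub_zero]
    rw [abs_of_nonneg h.1]
    exact h.2

theorem card_le_of_forall_mem_Icc {s : Finset ℕ} {a b : ℝ} (hab : a ≤ b)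
    (h : ∀ j ∈ s, (j : ℝ) ∈ Icc a b) : (s.card : ℝ) ≤ b - a + 1 := by
  have h1 : s.card ≤ (Finset.Icc ⌈a⌉ ⌊b⌋).card := by
    refine Finset.card_le_card_of_injOn (fun j : ℕ => (j : ℤ)) (fun j hj => ?_)
      (fun i _ j _ hij => Int.ofNat_injective hij)
    have := h j hj
    simp only [Finset.coe_Icc, mem_Icc]
    exact ⟨Int.ceil_le.2 (by exact_mod_cast this.1), Int.le_floor.2 (by exact_mod_cast this.2)⟩
  rw [Int.card_Icc] at h1
  have h2 : (s.card : ℝ) ≤ ((⌊b⌋ + 1 - ⌈a⌉).toNat : ℝ) := by exact_mod_cast h1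
  refine h2.trans ?_
  rw [← Int.cast_natCast, Int.toNat_eq_max, Int.cast_max]
  refine max_le ?_ (by push_cast; linarith)
  push_cast
  linarith [Int.floor_le b, Int.le_ceil a]

/-- A ball of radius `r ≥ 1` meets at most `4 r` of the slabs, and each of them in a set of
measure at most `m^{-nq/p} (2r)^{n-1}`. -/
theorem volume_shiftedSlab_inter_ball_le (hp : 0 < p) (hq : 0 < q)
    (x : EuclideanSpace ℝ (Fin n)) {r : ℝ} (hr : 1 ≤ r) :
    volume (shiftedSlab n p q m ∩ Metric.ball x r) ≤
      ENNReal.ofReal (2 ^ (n + 1) * r ^ n * (m : ℝ) ^ (-(n * q / p))) := by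
  classical
  set w : ℝ := (m : ℝ) ^ (-(n * q / p)) with hw
  have hw0 : 0 ≤ w := by positivity
  set S : Finset ℕ := (Finset.range m).filter fun j : ℕ =>
    (j : ℝ) ∈ Icc (x 0 - (m !) - r - 1) (x 0 - (m !) + r) with hS
  have hsub : shiftedSlab n p q m ∩ Metric.ball x r ⊆
      ⋃ j ∈ S, slabBox (m ! + j) (m ! + j + w) (fun i => x i - r) (fun i => x i + r) := by
    rintro y ⟨hy, hyr⟩
    rw [shiftedSlab_eq_iUnion] at hy
    simp only [mem_iUnion] at hy ⊢
    obtain ⟨j, hj, hj0, -⟩ := hy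
    have hc := fun i => abs_lt.1 (abs_sub_lt_of_mem_ball hyr i)
    refine ⟨j, Finset.mem_filter.2 ⟨hj, ?_⟩, hj0, fun i _ => ?_⟩
    · have := width_le_one (n := n) (m := m) hp hq
      have := hc 0
      exact ⟨by linarith [hj0.2], by linarith [hj0.1]⟩
    · exact ⟨by linarith [(hc i).1], by linarith [(hc i).2]⟩
  have hcard : (S.card : ℝ) ≤ 4 * r := by
    have := card_le_of_forall_mem_Icc (s := S) (a := x 0 - (m !) - r - 1) (b := x 0 - (m !) + r)
      (by linarith) fun j hj => (Finset.mem_filter.1 hj).2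
    linarith
  refine (measure_mono hsub).trans ((measure_biUnion_finset_le _ _).trans ?_)
  have hv : ∀ j : ℕ, volume (slabBox (n := n) (m ! + j) (m ! + j + w) (fun i => x i - r)
      (fun i => x i + r)) = ENNReal.ofReal (w * (2 * r) ^ (n - 1)) := by
    intro j
    have h2 : ∀ i, x i + r - (x i - r) = 2 * r := fun i => by ring
    rw [volume_slabBox, ENNReal.ofReal_mul hw0, ENNReal.ofReal_pow (by linarith)]
    simp [h2]
  simp only [hv, Finset.sum_const, nsmul_eq_mul]
  rw [← ENNReal.ofReal_natCast, ← ENNReal.ofReal_mul (Nat.cast_nonneg _)]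
  refine ENNReal.ofReal_le_ofReal ?_
  obtain ⟨k, hk⟩ : ∃ k, n = k + 1 := ⟨n - 1, (Nat.sub_add_cancel NeZero.one_le).symm⟩
  have hk' : n - 1 = k := by omega
  rw [hk']
  calc (S.card : ℝ) * (w * (2 * r) ^ k) ≤ (4 * r) * (w * (2 * r) ^ k) := by gcongr
    _ = 2 ^ (n + 1) * r ^ n * w := by rw [hk]; ring

end Slabs

/-! ### Growth of the measure of the union on balls -/

section Union

variable {n : ℕ} [NeZero n] {p q : ℝ}

/-- The union of the sets `m! e₁ + E_m`, `m ≥ 1`; `f₄` is almost everywhere its indicator. -/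
def slabUnion (n : ℕ) [NeZero n] (p q : ℝ) : Set (EuclideanSpace ℝ (Fin n)) :=
  ⋃ k : ℕ, shiftedSlab n p q (k + 1)

theorem measurableSet_slabUnion : MeasurableSet (slabUnion n p q) :=
  MeasurableSet.iUnion fun _ => measurableSet_shiftedSlab

/-- The complex-valued indicator function of `slabUnion`. -/
noncomputable def slabIndicator (n : ℕ) [NeZero n] (p q : ℝ) : EuclideanSpace ℝ (Fin n) → ℂ :=
  (slabUnion n p q).indicator 1

/-- Consecutive translated sets touch only for `m = 1, 2`, along the hyperplane `x₀ = 2`. -/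
theorem coord_zero_eq_two_of_mem_of_mem (hp : 0 < p) (hq : 0 < q) {a b : ℕ} (ha : 1 ≤ a)
    (hab : a < b) {x : EuclideanSpace ℝ (Fin n)} (hxa : x ∈ shiftedSlab n p q a)
    (hxb : x ∈ shiftedSlab n p q b) : a = 1 ∧ x 0 = 2 := by
  have h1 := (coord_zero_mem_of_mem_shiftedSlab hp hq hxa).2
  have h2 := (coord_zero_mem_of_mem_shiftedSlab hp hq hxb).1
  have h3 : b ! ≤ a ! + a := by exact_mod_cast h2.trans h1
  have h4 : (a + 1)! ≤ b ! := Nat.factorial_le hab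
  rw [Nat.factorial_succ] at h4
  have h5 : a ! ≤ 1 := by
    by_contra! h
    nlinarith
  have h6 : a ≤ 1 := (Nat.self_le_factorial a).trans h5
  obtain rfl : a = 1 := le_antisymm h6 ha
  have h7 : (2 : ℕ) ≤ b ! := by simpa using h4
  have h8 : (2 : ℝ) ≤ b ! := by exact_mod_cast h7
  refine ⟨rfl, le_antisymm ?_ (h8.trans h2)⟩
  norm_num at h1
  exact h1

theorem f₄_ae_eq (hp : 0 < p) (hq : 0 < q) :
    f₄ n p q =ᵐ[volume] slabIndicator n p q := by
  have h0 : volume (slabBox (n := n) 2 2 0 1) = 0 := by rw [volume_slabBox]; simp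
  filter_upwards [measure_eq_zero_iff_ae_notMem.1 h0] with x hx
  have huniq : ∀ a b : ℕ, a < b → x ∈ shiftedSlab n p q (a + 1) →
      x ∉ shiftedSlab n p q (b + 1) := by
    intro a b hab hxa hxb
    obtain ⟨h1, h2⟩ := coord_zero_eq_two_of_mem_of_mem hp hq (by omega) (by omega) hxa hxb
    refine hx ⟨by simp [h2], fun i hi => ?_⟩
    rw [h1, shiftedSlab_eq_iUnion] at hxa
    simp only [mem_iUnion] at hxa
    obtain ⟨j, -, -, h⟩ := hxa
    simpa using h i hi
  have hf : f₄ n p q x = ∑' k : ℕ, (shiftedSlab n p q (k + 1)).indicator 1 x := rfl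
  rw [hf, slabIndicator]
  by_cases hxA : x ∈ slabUnion n p q
  · obtain ⟨k, hk⟩ := mem_iUnion.1 hxA
    rw [tsum_eq_single k, indicator_of_mem hk, indicator_of_mem hxA]
    · intro j hj
      refine indicator_of_notMem (fun hxj => ?_) _
      rcases lt_or_gt_of_ne hj with h | h
      · exact huniq j k h hxj hk
      · exact huniq k j h hk hxj
  · rw [indicator_of_notMem hxA]
    have : ∀ k, x ∉ shiftedSlab n p q (k + 1) := fun k hk => hxA (mem_iUnion.2 ⟨k, hk⟩)
    simp [this]

/-- The factorial gaps: a ball of radius `r ≥ 1` meets at most one of the translated sets with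
`m! > 8 r`. -/
theorem eq_of_mem_ball_of_mem_ball (hp : 0 < p) (hq : 0 < q) {a b : ℕ} {r : ℝ} (hr : 1 ≤ r)
    (ha : 8 * r < a !) (hb : 8 * r < b !) {x : EuclideanSpace ℝ (Fin n)}
    (hxa : (shiftedSlab n p q a ∩ Metric.ball x r).Nonempty)
    (hxb : (shiftedSlab n p q b ∩ Metric.ball x r).Nonempty) : a = b := by
  have key : ∀ a b : ℕ, 8 * r < a ! → (shiftedSlab n p q a ∩ Metric.ball x r).Nonempty →
      (shiftedSlab n p q b ∩ Metric.ball x r).Nonempty → ¬ a < b := by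
    rintro a b ha ⟨y, hy, hyr⟩ ⟨z, hz, hzr⟩ hab
    have h1 := (coord_zero_mem_of_mem_shiftedSlab hp hq hy).2
    have h2 := (coord_zero_mem_of_mem_shiftedSlab hp hq hz).1
    have h3 := (abs_lt.1 (abs_sub_lt_of_mem_ball hyr 0)).1
    have h4 := (abs_lt.1 (abs_sub_lt_of_mem_ball hzr 0)).2
    have h5 : ((a : ℝ) + 1) * a ! ≤ b ! := by
      have := Nat.factorial_le hab
      rw [Nat.factorial_succ] at this
      exact_mod_cast this
    have ha1 : (1 : ℝ) ≤ a := by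
      rcases Nat.eq_zero_or_pos a with rfl | h
      · norm_num at ha; linarith
      · exact_mod_cast h
    nlinarith
  rcases lt_trichotomy a b with h | h | h
  · exact (key a b ha hxa hxb h).elim
  · exact h
  · exact (key b a hb hxb hxa h).elim

theorem volume_shiftedSlab_inter_ball_le_rpow (hq : 0 < q) (hqp : q < p) {m : ℕ} (hm : 1 ≤ m)
    (x : EuclideanSpace ℝ (Fin n)) {r : ℝ} (hr : 1 ≤ r) :
    volume (shiftedSlab n p q m ∩ Metric.ball x r) ≤
      ENNReal.ofReal (2 ^ (n + 1) * r ^ (n - n * q / p)) := by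
  have hp : 0 < p := hq.trans hqp
  have hn : (0 : ℝ) < n := by exact_mod_cast NeZero.pos n
  have hr0 : 0 < r := by linarith
  have hm0 : (0 : ℝ) < m := by exact_mod_cast hm
  have hα : 0 < n * q / p := by positivity
  have hβ : n * q / p < n := by rw [div_lt_iff₀ hp]; nlinarith
  rcases le_total (m : ℝ) r with h | h
  · refine (measure_mono inter_subset_left).trans ((volume_shiftedSlab_le hm).trans
      (ENNReal.ofReal_le_ofReal ?_))
    have h1 := Real.rpow_le_rpow hm0.le h (z := n - n * q / p) (by linarith)
    have h2 : (1 : ℝ) ≤ 2 ^ (n + 1) := one_le_pow₀ (by norm_num)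
    have h3 : 0 ≤ r ^ (n - n * q / p) := by positivity
    nlinarith
  · refine (volume_shiftedSlab_inter_ball_le hp hq x hr).trans (ENNReal.ofReal_le_ofReal ?_)
    rw [sub_eq_add_neg, Real.rpow_add hr0, Real.rpow_natCast, mul_assoc]
    have h1 := Real.rpow_le_rpow_of_nonpos hr0 h (z := -(n * q / p)) (by linarith)
    gcongr

theorem tsum_inv_factorial_rpow_ne_top {β : ℝ} (hβ : 0 < β) :
    ∑' k : ℕ, ENNReal.ofReal ((1 / (k ! : ℝ)) ^ β) ≠ ∞ := by
  have hfac : ∀ k : ℕ, (2 : ℝ) ^ k ≤ 2 * k ! := by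
    intro k
    induction k with
    | zero => norm_num
    | succ k ih =>
      rcases Nat.eq_zero_or_pos k with rfl | hk
      · norm_num
      · have hk' : (1 : ℝ) ≤ k := by exact_mod_cast hk
        rw [pow_succ, Nat.factorial_succ]
        push_cast
        have : (0 : ℝ) < k ! := by positivity
        nlinarith
  have hlt : ((1 : ℝ) / 2) ^ β < 1 := Real.rpow_lt_one (by norm_num) (by norm_num) hβ
  have hs : Summable fun k : ℕ => (1 / (k ! : ℝ)) ^ β := by
    refine Summable.of_nonneg_of_le (fun k => by positivity) (fun k => ?_)
      ((summable_geometric_of_lt_one (by positivity) hlt).mul_left ((2 : ℝ) ^ β))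
    rw [← Real.rpow_natCast, ← Real.rpow_mul (by norm_num), mul_comm β,
      Real.rpow_mul (by norm_num), Real.rpow_natCast, ← Real.mul_rpow (by norm_num) (by positivity)]
    refine Real.rpow_le_rpow (by positivity) ?_ hβ.le
    rw [one_div_pow, mul_one_div, div_le_div_iff₀ (by positivity) (by positivity), one_mul]
    exact hfac k
  exact hs.tsum_ofReal_ne_top

/-- The union has the growth `|A ∩ B(x, r)| = O(r^{n - nq/p})` for `r ≥ 1`. The sets with
`m! ≤ 8 r` are small altogether because `m = m! / (m - 1)!`, and at most one other set meets the
ball. -/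
theorem exists_volume_slabUnion_inter_ball_le (hq : 0 < q) (hqp : q < p) :
    ∃ C : ℝ≥0∞, C ≠ ∞ ∧ ∀ (x : EuclideanSpace ℝ (Fin n)) (r : ℝ), 1 ≤ r →
      volume (slabUnion n p q ∩ Metric.ball x r) ≤ C * ENNReal.ofReal (r ^ (n - n * q / p)) := by
  classical
  have hp : 0 < p := hq.trans hqp
  have hn : (0 : ℝ) < n := by exact_mod_cast NeZero.pos n
  have hβ : 0 < n - n * q / p := by
    have : n * q / p < n := by rw [div_lt_iff₀ hp]; nlinarith
    linarith
  set β : ℝ := n - n * q / p with hβdef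
  refine ⟨ENNReal.ofReal (8 ^ β) * (∑' k : ℕ, ENNReal.ofReal ((1 / (k ! : ℝ)) ^ β)) +
    ENNReal.ofReal (2 ^ (n + 1)), ?_, fun x r hr => ?_⟩
  · exact ENNReal.add_ne_top.2 ⟨ENNReal.mul_ne_top ENNReal.ofReal_ne_top
      (tsum_inv_factorial_rpow_ne_top hβ), ENNReal.ofReal_ne_top⟩
  have hr0 : 0 < r := by linarith
  obtain ⟨k₀, hk₀⟩ : ∃ k₀ : ℕ, ∀ k : ℕ, 8 * r < (k + 1)! →
      (shiftedSlab n p q (k + 1) ∩ Metric.ball x r).Nonempty → k = k₀ := by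
    by_cases h : ∃ k : ℕ, 8 * r < (k + 1)! ∧
        (shiftedSlab n p q (k + 1) ∩ Metric.ball x r).Nonempty
    · obtain ⟨k₀, h1, h2⟩ := h
      exact ⟨k₀, fun k h3 h4 =>
        Nat.succ_injective (eq_of_mem_ball_of_mem_ball hp hq hr h3 h1 h4 h2)⟩
    · exact ⟨0, fun k h3 h4 => (h ⟨k, h3, h4⟩).elim⟩
  have hterm : ∀ k : ℕ, volume (shiftedSlab n p q (k + 1) ∩ Metric.ball x r) ≤
      ENNReal.ofReal ((8 * r) ^ β) * ENNReal.ofReal ((1 / (k ! : ℝ)) ^ β) +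
        if k = k₀ then ENNReal.ofReal (2 ^ (n + 1) * r ^ β) else 0 := by
    intro k
    rcases le_or_gt ((k + 1)! : ℝ) (8 * r) with hk | hk
    · refine le_trans ?_ le_self_add
      refine (measure_mono inter_subset_left).trans ((volume_shiftedSlab_le (by omega)).trans ?_)
      rw [← ENNReal.ofReal_mul (by positivity), ← Real.mul_rpow (by positivity) (by positivity)]
      refine ENNReal.ofReal_le_ofReal (Real.rpow_le_rpow (by positivity) ?_ hβ.le)
      rw [mul_one_div, le_div_iff₀ (by positivity)]
      rw [Nat.factorial_succ] at hk
      exact_mod_cast hk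
    · rcases (shiftedSlab n p q (k + 1) ∩ Metric.ball x r).eq_empty_or_nonempty with h | h
      · rw [h, measure_empty]; exact zero_le
      · rw [if_pos (hk₀ k hk h)]
        exact (volume_shiftedSlab_inter_ball_le_rpow hq hqp (by omega) x hr).trans le_add_self
  rw [slabUnion, iUnion_inter]
  refine (measure_iUnion_le _).trans ((ENNReal.tsum_le_tsum hterm).trans_eq ?_)
  rw [ENNReal.tsum_add, ENNReal.tsum_mul_left, tsum_ite_eq, add_mul,
    Real.mul_rpow (by norm_num) hr0.le, ENNReal.ofReal_mul (by positivity),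
    ENNReal.ofReal_mul (by positivity)]
  ring

/-! ### `f₄` belongs to `V^{(*)} M^p_q` -/

theorem lintegral_ball_indicator_slabUnion {s : ℝ} (hs : 0 < s)
    (x : EuclideanSpace ℝ (Fin n)) (r : ℝ) :
    ∫⁻ y in Metric.ball x r, ‖slabIndicator n p q y‖ₑ ^ s =
      volume (slabUnion n p q ∩ Metric.ball x r) := by
  have : ∀ y, ‖slabIndicator n p q y‖ₑ ^ s =
      (slabUnion n p q).indicator 1 y := by
    intro y
    by_cases hy : y ∈ slabUnion n p q
    · simp [slabIndicator, indicator_of_mem hy]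
    · simp [slabIndicator, indicator_of_notMem hy, hs]
  simp only [this]
  rw [lintegral_indicator_one measurableSet_slabUnion,
    Measure.restrict_apply measurableSet_slabUnion]

theorem memMorrey_indicator_slabUnion (hq : 1 ≤ q) (hqp : q < p) :
    MemMorrey (slabIndicator n p q) p q := by
  have hq0 : 0 < q := by linarith
  have hp : 0 < p := hq0.trans hqp
  refine ⟨(stronglyMeasurable_one.indicator measurableSet_slabUnion).aestronglyMeasurable, ?_⟩
  obtain ⟨C, hC, hvol⟩ := exists_volume_slabUnion_inter_ball_le (n := n) hq0 hqp
  set v := volume (Metric.ball (0 : EuclideanSpace ℝ (Fin n)) 1) with hv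
  have hv0 : v ≠ 0 := (Metric.measure_ball_pos volume _ one_pos).ne'
  have hvt : v ≠ ∞ := measure_ball_lt_top.ne
  have hbound : v ^ (1 / p) + v ^ (1 / p) * (v⁻¹ * C) ^ (1 / q) < ∞ := by
    refine ENNReal.add_lt_top.2 ⟨ENNReal.rpow_lt_top_of_nonneg (by positivity) hvt,
      ENNReal.mul_lt_top (ENNReal.rpow_lt_top_of_nonneg (by positivity) hvt)
      (ENNReal.rpow_lt_top_of_nonneg (by positivity) (ENNReal.mul_ne_top ?_ hC))⟩
    exact ENNReal.inv_ne_top.2 hv0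
  refine lt_of_le_of_lt (iSup₂_le fun r hr => iSup_le fun x => ?_) hbound
  rw [lintegral_ball_indicator_slabUnion hq0]
  have hV0 : volume (Metric.ball x r) ≠ 0 := (Metric.measure_ball_pos volume _ hr).ne'
  have hVt : volume (Metric.ball x r) ≠ ∞ := measure_ball_lt_top.ne
  rcases le_total r 1 with h1 | h1
  · refine le_trans ?_ le_self_add
    have h2 : (volume (Metric.ball x r))⁻¹ * volume (slabUnion n p q ∩ Metric.ball x r) ≤ 1 := by
      rw [← ENNReal.inv_mul_cancel hV0 hVt]
      gcongr
      exact inter_subset_right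
    have h3 : volume (Metric.ball x r) ≤ v := by
      rw [volume_ball_eq x hr.le]
      refine mul_le_of_le_one_left' (pow_le_one' ?_ n)
      simpa using ENNReal.ofReal_le_ofReal h1
    calc volume (Metric.ball x r) ^ (1 / p) *
          ((volume (Metric.ball x r))⁻¹ * volume (slabUnion n p q ∩ Metric.ball x r)) ^ (1 / q)
        ≤ v ^ (1 / p) * 1 ^ (1 / q) := by gcongr
      _ = v ^ (1 / p) := by simp
  · refine le_trans ?_ le_add_self
    have hR0 : ENNReal.ofReal r ≠ 0 := (ENNReal.ofReal_pos.2 hr).ne'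
    have hRt : ENNReal.ofReal r ≠ ∞ := ENNReal.ofReal_ne_top
    set R := ENNReal.ofReal r with hR
    have hpow : ∀ s : ℝ, R ^ s ≠ ∞ := fun s => ENNReal.rpow_ne_top_of_ne_zero hR0 hRt
    have hV : volume (Metric.ball x r) = R ^ (n : ℝ) * v := by
      rw [volume_ball_eq x hr.le, ENNReal.rpow_natCast]
    have h2 : (volume (Metric.ball x r))⁻¹ * volume (slabUnion n p q ∩ Metric.ball x r) ≤
        R ^ (-(n * q / p)) * (v⁻¹ * C) := by
      refine (mul_le_mul_right (hvol x r h1) _).trans_eq ?_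
      rw [hV, ENNReal.mul_inv (Or.inr hvt) (Or.inr hv0), ← ENNReal.rpow_neg,
        ← ENNReal.ofReal_rpow_of_pos hr, ← hR]
      have : R ^ (-(n * q / p)) = R ^ (-(n : ℝ)) * R ^ (n - n * q / p) := by
        rw [← ENNReal.rpow_add _ _ hR0 hRt]; congr 1; ring
      rw [this]
      ring
    calc volume (Metric.ball x r) ^ (1 / p) *
          ((volume (Metric.ball x r))⁻¹ * volume (slabUnion n p q ∩ Metric.ball x r)) ^ (1 / q)
        ≤ (R ^ (n : ℝ) * v) ^ (1 / p) * (R ^ (-(n * q / p)) * (v⁻¹ * C)) ^ (1 / q) := by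
          rw [← hV]; gcongr
      _ = (R ^ (n / p) * R ^ (-(n / p))) * (v ^ (1 / p) * (v⁻¹ * C) ^ (1 / q)) := by
          rw [ENNReal.mul_rpow_of_nonneg _ _ (by positivity),
            ENNReal.mul_rpow_of_nonneg _ _ (by positivity), ← ENNReal.rpow_mul,
            ← ENNReal.rpow_mul, mul_one_div,
            show -(n * q / p) * (1 / q) = -(n / p) by field_simp]
          ring
      _ = v ^ (1 / p) * (v⁻¹ * C) ^ (1 / q) := by
          rw [← ENNReal.rpow_add _ _ hR0 hRt, add_neg_cancel, ENNReal.rpow_zero, one_mul]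

/-- Far from the origin only sets `m! e₁ + E_m` with large `m` are present, and a unit ball meets
one of them at most, in a set of measure `O(m^{-nq/p})`. -/
theorem tailMass_indicator_slabUnion_le (hq : 0 < q) (hqp : q < p) {M N : ℕ} (hM : 4 ≤ M)
    (hN : M ! + n * M < N) : tailMass (slabIndicator n p q) q N ≤
      ENNReal.ofReal (2 ^ (n + 1) * (M : ℝ) ^ (-(n * q / p))) := by
  have hp : 0 < p := hq.trans hqp
  have hn : (0 : ℝ) < n := by exact_mod_cast NeZero.pos n
  have hα : 0 < n * q / p := by positivity
  refine iSup_le fun x => ?_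
  set T : Set (EuclideanSpace ℝ (Fin n)) :=
    slabUnion n p q ∩ (Metric.ball 0 (N : ℝ))ᶜ with hT
  have hTm : MeasurableSet T :=
    measurableSet_slabUnion.inter Metric.isOpen_ball.measurableSet.compl
  have h1 : ∀ y, (Metric.ball (0 : EuclideanSpace ℝ (Fin n)) (N : ℝ))ᶜ.indicator
      (fun y => ‖slabIndicator n p q y‖ₑ ^ q) y = T.indicator 1 y := by
    intro y
    rw [hT, inter_comm, ← indicator_indicator]
    congr 1
    funext z
    by_cases hz : z ∈ slabUnion n p q
    · simp [slabIndicator, indicator_of_mem hz]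
    · simp [slabIndicator, indicator_of_notMem hz, hq]
  simp only [h1]
  rw [lintegral_indicator_one hTm, Measure.restrict_apply hTm]
  have hlarge : ∀ k : ℕ, ∀ y ∈ shiftedSlab n p q (k + 1), y ∉ Metric.ball 0 (N : ℝ) → M ≤ k := by
    intro k y hy hyN
    by_contra! hk
    refine hyN (mem_ball_zero_iff.2 ?_)
    have h2 := norm_sub_le_of_mem_shiftedSlab hp hq hy
    have h3 : ‖((k + 1)! : ℝ) • EuclideanSpace.single (0 : Fin n) (1 : ℝ)‖ = (k + 1)! := by
      simp [norm_smul]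
    have h4 : ‖y‖ ≤ n * ((k + 1 : ℕ) : ℝ) + (k + 1)! := by
      have := norm_le_norm_sub_add y (((k + 1)! : ℝ) • EuclideanSpace.single (0 : Fin n) (1 : ℝ))
      linarith
    have h5 : (k + 1)! ≤ M ! := Nat.factorial_le hk
    have h6 : n * (k + 1) ≤ n * M := Nat.mul_le_mul_left n hk
    have h7 : n * (k + 1) + (k + 1)! < N := by omega
    exact h4.trans_lt (by exact_mod_cast h7)
  rcases (T ∩ Metric.ball x 1).eq_empty_or_nonempty with h | ⟨y, ⟨hyA, hyN⟩, hyx⟩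
  · rw [h, measure_empty]; exact zero_le
  obtain ⟨k, hk⟩ := mem_iUnion.1 hyA
  have hMk := hlarge k y hk hyN
  have hfac : ∀ j : ℕ, M ≤ j → (8 : ℝ) * 1 < (j + 1)! := by
    intro j hj
    have h1 : 4 ! ≤ (j + 1)! := Nat.factorial_le (by omega)
    have h2 : 4 ! = 24 := rfl
    have h3 : (24 : ℝ) ≤ (j + 1)! := by exact_mod_cast h2 ▸ h1
    linarith
  have hsub : T ∩ Metric.ball x 1 ⊆ shiftedSlab n p q (k + 1) ∩ Metric.ball x 1 := by
    rintro z ⟨⟨hzA, hzN⟩, hzx⟩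
    obtain ⟨j, hj⟩ := mem_iUnion.1 hzA
    have hjk : j + 1 = k + 1 := eq_of_mem_ball_of_mem_ball hp hq le_rfl
      (hfac j (hlarge j z hj hzN)) (hfac k hMk) ⟨z, hj, hzx⟩ ⟨y, hk, hyx⟩
    exact ⟨hjk ▸ hj, hzx⟩
  refine (measure_mono hsub).trans ((volume_shiftedSlab_inter_ball_le hp hq x le_rfl).trans
    (ENNReal.ofReal_le_ofReal ?_))
  rw [one_pow, mul_one]
  have hM0 : (0 : ℝ) < M := by exact_mod_cast (by omega : 0 < M)
  have := Real.rpow_le_rpow_of_nonpos hM0 (y := ((k + 1 : ℕ) : ℝ))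
    (by exact_mod_cast (by omega : M ≤ k + 1)) (z := -(n * q / p)) (by linarith)
  gcongr

theorem memVStar_f₄ (hq : 1 ≤ q) (hqp : q < p) : MemVStar (f₄ n p q) p q := by
  have hq0 : 0 < q := by linarith
  have hp : 0 < p := hq0.trans hqp
  have hn : (0 : ℝ) < n := by exact_mod_cast NeZero.pos n
  refine MemVStar.congr (f := slabIndicator n p q) ⟨memMorrey_indicator_slabUnion hq hqp,
    ?_⟩ (f₄_ae_eq hp hq0).symm
  have hlim : Tendsto (fun M : ℕ => ENNReal.ofReal (2 ^ (n + 1) * (M : ℝ) ^ (-(n * q / p))))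
      atTop (𝓝 0) := by
    have h1 := ((tendsto_rpow_neg_atTop (y := n * q / p) (by positivity)).comp
      tendsto_natCast_atTop_atTop).const_mul ((2 : ℝ) ^ (n + 1))
    rw [mul_zero] at h1
    simpa using ENNReal.tendsto_ofReal h1
  rw [ENNReal.tendsto_nhds_zero]
  intro ε hε
  obtain ⟨M, h1, h2⟩ := ((ENNReal.tendsto_nhds_zero.1 hlim ε hε).and
    (eventually_ge_atTop 4)).exists
  filter_upwards [eventually_gt_atTop (M ! + n * M)] with N hN
  exact (tailMass_indicator_slabUnion_le hq0 hqp h2 hN).trans h1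

end Union

/-! ### Averages over the sets `m! e₁ + E_m` -/

section Averages

variable {n : ℕ} [NeZero n] {p q : ℝ}

/-- By Hölder's inequality the average of `|u|` over `m! e₁ + E_m` is controlled by the Morrey
mean of `u` at a radius comparable to `m`: the set lies in a ball of radius `(n + 1) m` and has
the largest measure `m^{n - nq/p}` that the Morrey condition allows. -/
theorem exists_average_le_morreyMean (hq : 1 ≤ q) (hqp : q < p) :
    ∃ K : ℝ≥0∞, K ≠ ∞ ∧ ∀ u : EuclideanSpace ℝ (Fin n) → ℂ, AEStronglyMeasurable u volume →
      ∀ m : ℕ, 2 ≤ m →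
        (volume (shiftedSlab n p q m))⁻¹ * ∫⁻ y in shiftedSlab n p q m, ‖u y‖ₑ ≤
          K * morreyMean u p q ((n + 1) * m) := by
  have hq0 : 0 < q := by linarith
  have hp : 0 < p := hq0.trans hqp
  have hexp : 0 ≤ 1 / q - 1 / p := sub_nonneg.2 (one_div_le_one_div_of_le hq0 hqp.le)
  set v := volume (Metric.ball (0 : EuclideanSpace ℝ (Fin n)) 1) with hv
  have hvt : v ≠ ∞ := measure_ball_lt_top.ne
  refine ⟨(ENNReal.ofReal (n + 1) ^ n * v) ^ (1 / q - 1 / p),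
    ENNReal.rpow_ne_top_of_nonneg hexp (ENNReal.mul_ne_top (by finiteness) hvt),
    fun u hu m hm => ?_⟩
  have hm0 : (0 : ℝ) < m := by exact_mod_cast (by omega : 0 < m)
  set A := shiftedSlab n p q m with hA
  set c : EuclideanSpace ℝ (Fin n) := (m ! : ℝ) • EuclideanSpace.single (0 : Fin n) (1 : ℝ)
  set r : ℝ := (n + 1) * m with hr
  have hr0 : 0 < r := by positivity
  have hAB : A ⊆ Metric.ball c r := fun x hx => by
    have := norm_sub_le_of_mem_shiftedSlab hp hq0 hx
    rw [mem_ball_iff_norm]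
    linarith
  set V := volume (Metric.ball c r) with hV
  have hV0 : V ≠ 0 := (Metric.measure_ball_pos volume _ hr0).ne'
  have hVt : V ≠ ∞ := measure_ball_lt_top.ne
  set R : ℝ≥0∞ := ENNReal.ofReal m with hR
  have hR0 : R ≠ 0 := (ENNReal.ofReal_pos.2 hm0).ne'
  have hRt : R ≠ ∞ := ENNReal.ofReal_ne_top
  have hvolA : volume A = R ^ (n - n * q / p) := by
    rw [hA, volume_shiftedSlab hp hq0 hm, hR, ENNReal.ofReal_rpow_of_pos hm0]
  have hA0 : volume A ≠ 0 := by
    rw [hvolA]; exact (ENNReal.rpow_pos (pos_iff_ne_zero.2 hR0) hRt).ne'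
  have hAt : volume A ≠ ∞ := by
    rw [hvolA]; exact ENNReal.rpow_ne_top_of_ne_zero hR0 hRt
  set J := ∫⁻ y in Metric.ball c r, ‖u y‖ₑ ^ q with hJ
  have h1 : ∫⁻ y in A, ‖u y‖ₑ ≤ J ^ (1 / q) * volume A ^ (1 - 1 / q) := by
    have h := eLpNorm'_le_eLpNorm'_mul_rpow_measure_univ (μ := volume.restrict A) one_pos hq
      hu.restrict
    simp only [eLpNorm'_eq_lintegral_enorm, ENNReal.rpow_one, one_div_one,
      Measure.restrict_apply_univ] at h
    refine h.trans (mul_le_mul_left (ENNReal.rpow_le_rpow (lintegral_mono_set hAB) ?_) _)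
    positivity
  have h2 : V ^ (1 / p) * (V⁻¹ * J) ^ (1 / q) ≤ morreyMean u p q r :=
    le_iSup (fun x => volume (Metric.ball x r) ^ (1 / p) *
      ((volume (Metric.ball x r))⁻¹ * ∫⁻ y in Metric.ball x r, ‖u y‖ₑ ^ q) ^ (1 / q)) c
  have h3 : V ^ (1 / p) * (V⁻¹ * J) ^ (1 / q) = V ^ (1 / p - 1 / q) * J ^ (1 / q) := by
    rw [ENNReal.mul_rpow_of_nonneg _ _ (by positivity), ENNReal.inv_rpow, ← ENNReal.rpow_neg,
      ← mul_assoc, ← ENNReal.rpow_add _ _ hV0 hVt, ← sub_eq_add_neg]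
  have h4 : V = (ENNReal.ofReal (n + 1) ^ n * v) * R ^ (n : ℝ) := by
    rw [hV, volume_ball_eq c hr0.le, hr, ENNReal.ofReal_mul (by positivity), mul_pow,
      ENNReal.rpow_natCast]
    ring
  have h5 : (volume A) ^ (-(1 / q)) * V ^ (1 / q - 1 / p) =
      (ENNReal.ofReal (n + 1) ^ n * v) ^ (1 / q - 1 / p) := by
    rw [hvolA, h4, ENNReal.mul_rpow_of_nonneg _ _ hexp, ← ENNReal.rpow_mul, ← ENNReal.rpow_mul,
      mul_left_comm, ← ENNReal.rpow_add _ _ hR0 hRt,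
      show (n - n * q / p) * -(1 / q) + n * (1 / q - 1 / p) = 0 by field_simp; ring,
      ENNReal.rpow_zero, mul_one]
  calc (volume A)⁻¹ * ∫⁻ y in A, ‖u y‖ₑ
      ≤ (volume A) ^ (-1 : ℝ) * (J ^ (1 / q) * volume A ^ (1 - 1 / q)) := by
        rw [ENNReal.rpow_neg_one]; gcongr
    _ = (volume A) ^ (-(1 / q)) * J ^ (1 / q) := by
        rw [mul_left_comm, ← ENNReal.rpow_add _ _ hA0 hAt, mul_comm]
        congr 2; ring
    _ = (volume A) ^ (-(1 / q)) * (V ^ (1 / q - 1 / p) * V ^ (1 / p - 1 / q)) * J ^ (1 / q) := by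
        rw [← ENNReal.rpow_add _ _ hV0 hVt, sub_add_sub_cancel, sub_self, ENNReal.rpow_zero,
          mul_one]
    _ = (ENNReal.ofReal (n + 1) ^ n * v) ^ (1 / q - 1 / p) *
          (V ^ (1 / p - 1 / q) * J ^ (1 / q)) := by
        rw [← h5]; ring
    _ ≤ _ := by rw [← h3]; gcongr

theorem MemVInf.tendsto_average (hq : 1 ≤ q) (hqp : q < p) {u : EuclideanSpace ℝ (Fin n) → ℂ}
    (hu : MemVInf u p q) :
    Tendsto (fun m : ℕ => (volume (shiftedSlab n p q m))⁻¹ *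
      ∫⁻ y in shiftedSlab n p q m, ‖u y‖ₑ) atTop (𝓝 0) := by
  obtain ⟨K, hK, h⟩ := exists_average_le_morreyMean (n := n) hq hqp
  have h1 : Tendsto (fun m : ℕ => ((n : ℝ) + 1) * m) atTop atTop :=
    tendsto_natCast_atTop_atTop.const_mul_atTop (by positivity)
  have h2 := ENNReal.Tendsto.const_mul (hu.2.comp h1) (Or.inr hK)
  rw [mul_zero] at h2
  refine tendsto_of_tendsto_of_tendsto_of_le_of_le' tendsto_const_nhds h2
    (Eventually.of_forall fun _ => zero_le) ?_
  filter_upwards [eventually_ge_atTop 2] with m hm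
  exact h u hu.1.1 m hm

theorem average_f₄ (hp : 0 < p) (hq : 0 < q) {m : ℕ} (hm : 2 ≤ m) :
    (volume (shiftedSlab n p q m))⁻¹ * ∫⁻ y in shiftedSlab n p q m, ‖f₄ n p q y‖ₑ = 1 := by
  have hm0 : (0 : ℝ) < m := by exact_mod_cast (by omega : 0 < m)
  have h : ∫⁻ y in shiftedSlab n p q m, ‖f₄ n p q y‖ₑ = ∫⁻ y in shiftedSlab n p q m, 1 := by
    refine lintegral_congr_ae ?_
    filter_upwards [ae_restrict_of_ae (f₄_ae_eq (n := n) hp hq),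
      ae_restrict_mem measurableSet_shiftedSlab] with y hy hyA
    have hyU : y ∈ slabUnion n p q :=
      mem_iUnion.2 ⟨m - 1, by rwa [Nat.sub_add_cancel (by omega)]⟩
    simp [hy, slabIndicator, indicator_of_mem hyU]
  rw [h, setLIntegral_one, volume_shiftedSlab hp hq hm]
  exact ENNReal.inv_mul_cancel (ENNReal.ofReal_pos.2 (by positivity)).ne' ENNReal.ofReal_ne_top

theorem slabSet_congr {p' q' : ℝ} (h : q' / p' = q / p) (m : ℕ) :
    slabSet n p' q' m = slabSet n p q m := by
  simp only [slabSet, mul_div_assoc, h]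

theorem f₄_congr {p' q' : ℝ} (h : q' / p' = q / p) : f₄ n p' q' = f₄ n p q := by
  funext x
  simp only [f₄, slabSet_congr h]

theorem shiftedSlab_congr {p' q' : ℝ} (h : q' / p' = q / p) (m : ℕ) :
    shiftedSlab n p' q' m = shiftedSlab n p q m := by
  simp only [shiftedSlab, slabSet_congr h]

/-- `f₄` is not even in the sum `V_∞ M^{p₀}_{q₀} + V_∞ M^{p₁}_{q₁}`. -/
theorem not_f₄_ae_eq_add {p₀ q₀ p₁ q₁ : ℝ} (hp : 0 < p) (hq : 0 < q) (hq₀ : 1 ≤ q₀)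
    (hqp₀ : q₀ < p₀) (hq₁ : 1 ≤ q₁) (hqp₁ : q₁ < p₁) (h₀ : q₀ / p₀ = q / p)
    (h₁ : q₁ / p₁ = q / p) {u v : EuclideanSpace ℝ (Fin n) → ℂ} (hu : MemVInf u p₀ q₀)
    (hv : MemVInf v p₁ q₁) : ¬ f₄ n p q =ᵐ[volume] u + v := by
  intro hf
  have h := (hu.tendsto_average hq₀ hqp₀).add (hv.tendsto_average hq₁ hqp₁)
  simp only [shiftedSlab_congr h₀, shiftedSlab_congr h₁, add_zero] at h
  refine absurd (ge_of_tendsto h (b := 1) ?_) (by simp)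
  filter_upwards [eventually_ge_atTop 2] with m hm
  rw [← average_f₄ (n := n) hp hq hm, ← mul_add, ← lintegral_add_left' hu.1.1.enorm.restrict]
  refine mul_le_mul_right (lintegral_mono_ae ?_) _
  filter_upwards [ae_restrict_of_ae hf] with y hy
  rw [hy]
  exact enorm_add_le _ _

end Averages

/-! ### The second complex interpolation space lies between intersection and sum -/

namespace CompatibleCouple

variable {X₀ X₁ Z : Type*}
    [NormedAddCommGroup X₀] [NormedSpace ℂ X₀] [NormedAddCommGroup X₁] [NormedSpace ℂ X₁]
    [AddCommGroup Z] [Module ℂ Z] [TopologicalSpace Z] [IsTopologicalAddGroup Z]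
    [ContinuousSMul ℂ Z] [T2Space Z] (c : CompatibleCouple X₀ X₁ Z)

theorem toZ_mkSum (x : WithLp 1 (X₀ × X₁)) : c.toZ (c.mkSum x) = c.ι₀ x.fst + c.ι₁ x.snd :=
  rfl

theorem incl₀_eq_incl₁ {x₀ : X₀} {x₁ : X₁} (h : c.ι₀ x₀ = c.ι₁ x₁) :
    c.incl₀ x₀ = c.incl₁ x₁ := by
  refine (Submodule.Quotient.eq c.relations).2 (LinearMap.mem_ker.2 ?_)
  change c.ι₀ (x₀ - 0) + c.ι₁ (0 - x₁) = 0
  simp [h]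

theorem smul_incl₀ (z : ℂ) (x : X₀) : z • c.incl₀ x = c.incl₀ (z • x) := by
  rw [incl₀, incl₀, ← map_smul, ← WithLp.toLp_smul, Prod.smul_mk, smul_zero]

theorem smul_incl₁ (z : ℂ) (x : X₁) : z • c.incl₁ x = c.incl₁ (z • x) := by
  rw [incl₁, incl₁, ← map_smul, ← WithLp.toLp_smul, Prod.smul_mk, smul_zero]

theorem hasDerivAt_smul_incl₀ (x : X₀) (z : ℂ) :
    HasDerivAt (fun z : ℂ => z • c.incl₀ x) (c.incl₀ x) z := by
  simpa using (hasDerivAt_id z).smul_const (c.incl₀ x)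

theorem memG_smul_incl₀ {x₀ : X₀} {x₁ : X₁} (h : c.ι₀ x₀ = c.ι₁ x₁) :
    c.MemG fun z => z • c.incl₀ x₀ := by
  refine ⟨?_, ?_, ⟨‖c.incl₀ x₀‖, fun z _ => ?_⟩, ?_, ?_⟩
  · exact fun z _ => (c.hasDerivAt_smul_incl₀ x₀ z).continuousAt.continuousWithinAt
  · exact fun z _ => (c.hasDerivAt_smul_incl₀ x₀ z).differentiableAt.differentiableWithinAt
  · rw [norm_smul]
    nlinarith [norm_nonneg (c.incl₀ x₀)]
  · refine ⟨fun t => (t * Complex.I : ℂ) • x₀, fun t => c.smul_incl₀ _ _, ‖x₀‖₊,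
      LipschitzWith.of_dist_le_mul fun s t => ?_⟩
    rw [dist_eq_norm, ← sub_smul, ← sub_mul, norm_smul, norm_mul, Complex.norm_I, mul_one,
      ← Complex.ofReal_sub, Complex.norm_real, dist_eq_norm, mul_comm, coe_nnnorm]
  · refine ⟨fun t => (1 + t * Complex.I : ℂ) • x₁, fun t => ?_, ‖x₁‖₊,
      LipschitzWith.of_dist_le_mul fun s t => ?_⟩
    · rw [c.incl₀_eq_incl₁ h, c.smul_incl₁]
    · rw [dist_eq_norm, ← sub_smul, add_sub_add_left_eq_sub, ← sub_mul, norm_smul, norm_mul,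
        Complex.norm_I, mul_one, ← Complex.ofReal_sub, Complex.norm_real, dist_eq_norm, mul_comm,
        coe_nnnorm]

/-- An element of `X₀ ∩ X₁` belongs to every second interpolation space: take `G z = z x`. -/
theorem mem_secondInterp_of_eq {x₀ : X₀} {x₁ : X₁} (h : c.ι₀ x₀ = c.ι₁ x₁) (θ : ℝ) :
    c.ι₀ x₀ ∈ c.secondInterp θ := by
  have hd : c.ι₀ x₀ = c.toZ (deriv (fun z : ℂ => z • c.incl₀ x₀) θ) := by
    rw [(c.hasDerivAt_smul_incl₀ x₀ θ).deriv, incl₀, toZ_mkSum]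
    simp
  exact ⟨_, c.memG_smul_incl₀ h, hd⟩

/-- The derivative of `G` takes values in the space `X₀ + X₁` itself, which is an algebraic sum. -/
theorem exists_add_of_mem_secondInterp {θ : ℝ} {z : Z} (hz : z ∈ c.secondInterp θ) :
    ∃ x₀ x₁, z = c.ι₀ x₀ + c.ι₁ x₁ := by
  obtain ⟨G, -, rfl⟩ := hz
  obtain ⟨x, hx⟩ := Submodule.Quotient.mk_surjective c.relations (deriv G (θ : ℂ))
  exact ⟨x.fst, x.snd, (congrArg c.toZ hx).symm⟩

end CompatibleCouple

namespace Morrey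

variable {n : ℕ} {p₀ q₀ p₁ q₁ : ℝ} {hq₀ : 1 ≤ q₀} {hq₁ : 1 ≤ q₁}
  (V₀ : Submodule ℂ (Morrey n p₀ q₀ hq₀)) (V₁ : Submodule ℂ (Morrey n p₁ q₁ hq₁))

theorem coe_couple_ι₀ (x : V₀) : ((couple V₀ V₁).ι₀ x : EuclideanSpace ℝ (Fin n) →ₘ[volume] ℂ) =
    (x : Morrey n p₀ q₀ hq₀) := rfl

theorem coe_couple_ι₁ (x : V₁) : ((couple V₀ V₁).ι₁ x : EuclideanSpace ℝ (Fin n) →ₘ[volume] ℂ) =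
    (x : Morrey n p₁ q₁ hq₁) := rfl

variable {V₀ V₁} {f : EuclideanSpace ℝ (Fin n) → ℂ}

theorem belongsTo_secondInterp_couple {x₀ : V₀} {x₁ : V₁}
    (h : ((x₀ : Morrey n p₀ q₀ hq₀) : EuclideanSpace ℝ (Fin n) →ₘ[volume] ℂ) =
      (x₁ : Morrey n p₁ q₁ hq₁))
    (hf : f =ᵐ[volume] ((x₀ : Morrey n p₀ q₀ hq₀) : EuclideanSpace ℝ (Fin n) →ₘ[volume] ℂ))
    (θ : ℝ) : BelongsTo f ((couple V₀ V₁).secondInterp θ) := by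
  refine ⟨(couple V₀ V₁).ι₀ x₀, (couple V₀ V₁).mem_secondInterp_of_eq (x₁ := x₁) ?_ θ, ?_⟩
  · refine Subtype.ext ?_
    rw [coe_couple_ι₀, coe_couple_ι₁, h]
  · rwa [coe_couple_ι₀]

theorem exists_ae_eq_add_of_belongsTo {θ : ℝ}
    (h : BelongsTo f ((couple V₀ V₁).secondInterp θ)) : ∃ (x₀ : V₀) (x₁ : V₁), f =ᵐ[volume]
      ((x₀ : Morrey n p₀ q₀ hq₀) : EuclideanSpace ℝ (Fin n) →ₘ[volume] ℂ) +
        ((x₁ : Morrey n p₁ q₁ hq₁) : EuclideanSpace ℝ (Fin n) →ₘ[volume] ℂ) := by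
  obtain ⟨g, hg, hfg⟩ := h
  obtain ⟨x₀, x₁, rfl⟩ := (couple V₀ V₁).exists_add_of_mem_secondInterp hg
  refine ⟨x₀, x₁, hfg.trans ?_⟩
  rw [Submodule.coe_add, coe_couple_ι₀, coe_couple_ι₁]
  exact AEEqFun.coeFn_add _ _

end Morrey

theorem corollary6p6 (n : ℕ) [NeZero n] (θ p₀ q₀ p₁ q₁ p q : ℝ)
    (hθ : θ ∈ Ioo (0 : ℝ) 1)
    (hq₀ : 1 ≤ q₀) (hqp₀ : q₀ < p₀) (hq₁ : 1 ≤ q₁) (hqp₁ : q₁ < p₁)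
    (hratio : p₀ / q₀ = p₁ / q₁)
    (hp : 1 / p = (1 - θ) / p₀ + θ / p₁) (hq : 1 / q = (1 - θ) / q₀ + θ / q₁) :
    (BelongsTo (f₄ n p q)
        ((Morrey.couple (Morrey.vStar n p₀ q₀ hq₀) (Morrey.vStar n p₁ q₁ hq₁)).secondInterp θ) ∧
      ¬ BelongsTo (f₄ n p q)
        ((Morrey.couple (Morrey.vInf n p₀ q₀ hq₀) (Morrey.vInf n p₁ q₁ hq₁)).secondInterp θ)) ∧
    (MemVStar (f₄ n p q) p q ∧ ¬ MemVInf (f₄ n p q) p q) := by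
  obtain ⟨hθ0, hθ1⟩ := hθ
  have hq₀' : 0 < q₀ := by linarith
  have hq₁' : 0 < q₁ := by linarith
  have hp₀' : 0 < p₀ := by linarith
  have hp₁' : 0 < p₁ := by linarith
  have hpp : 0 < 1 / p := by
    rw [hp]; exact add_pos (div_pos (by linarith) hp₀') (div_pos hθ0 hp₁')
  have hqq : 0 < 1 / q := by
    rw [hq]; exact add_pos (div_pos (by linarith) hq₀') (div_pos hθ0 hq₁')
  have hp' : 0 < p := one_div_pos.1 hpp
  have hq' : 0 < q := one_div_pos.1 hqq
  have hq1 : 1 ≤ q := by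
    have h0 : (1 - θ) / q₀ ≤ 1 - θ := div_le_self (by linarith) hq₀
    have h1 : θ / q₁ ≤ θ := div_le_self hθ0.le hq₁
    have h2 : 1 / q ≤ 1 := by linarith
    rwa [div_le_one hq'] at h2
  have h10 : q₁ / p₁ = q₀ / p₀ := by
    rw [div_eq_div_iff hq₀'.ne' hq₁'.ne'] at hratio
    rw [div_eq_div_iff hp₁'.ne' hp₀'.ne']
    linarith
  -- All three exponent pairs have the same ratio, so they define the same function.
  have h0 : q₀ / p₀ = q / p := by
    have e0 : (1 - θ) / p₀ = q₀ / p₀ * ((1 - θ) / q₀) := by field_simp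
    have e1 : θ / p₁ = q₀ / p₀ * (θ / q₁) := by rw [← h10]; field_simp
    have e2 : 1 / p = q₀ / p₀ * (1 / q) := by rw [hp, hq, e0, e1]; ring
    field_simp at e2 ⊢
    linarith
  have h1 : q₁ / p₁ = q / p := h10.trans h0
  have hqp : q < p := by
    have : q₀ / p₀ < 1 := (div_lt_one hp₀').2 hqp₀
    rwa [h0, div_lt_one hp'] at this
  refine ⟨⟨?_, ?_⟩, memVStar_f₄ hq1 hqp, fun h => ?_⟩
  · have m₀ : MemVStar (f₄ n p q) p₀ q₀ := f₄_congr (n := n) h0 ▸ memVStar_f₄ hq₀ hqp₀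
    have m₁ : MemVStar (f₄ n p q) p₁ q₁ := f₄_congr (n := n) h1 ▸ memVStar_f₄ hq₁ hqp₁
    have hmk := (AEEqFun.coeFn_mk (f₄ n p q) m₀.1.1).symm
    let x₀ : Morrey.vStar n p₀ q₀ hq₀ := ⟨⟨AEEqFun.mk _ m₀.1.1, m₀.1.congr hmk⟩, m₀.congr hmk⟩
    let x₁ : Morrey.vStar n p₁ q₁ hq₁ := ⟨⟨AEEqFun.mk _ m₀.1.1, m₁.1.congr hmk⟩, m₁.congr hmk⟩
    exact Morrey.belongsTo_secondInterp_couple (x₀ := x₀) (x₁ := x₁) rfl hmk θ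
  · intro h
    obtain ⟨u, v, huv⟩ := Morrey.exists_ae_eq_add_of_belongsTo h
    exact not_f₄_ae_eq_add hp' hq' hq₀ hqp₀ hq₁ hqp₁ h0 h1 u.2 v.2 huv
  · exact not_f₄_ae_eq_add hp' hq' hq1 hqp hq1 hqp rfl rfl h
      (v := 0) ⟨MemMorrey.zero hq1, by simp only [morreyMean_zero hq1, tendsto_const_nhds]⟩
      (by rw [add_zero])
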